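/- A graph is a comparability graph if its edges have a transitive orientation (whenever $xy$ is oriented from $x$ to $y$ and $yz$ from $y$ to $z$, then $xz$ is an edge and is oriented from $x$ to $z$), and a co-comparability graph if its complement is a comparability graph. For a finite graph $G$ with chromatic number $\chi(G)$, the type of a proper vertex coloring of $G$ with $\chi(G)$ colors is the list, in non-decreasing order, of the sizes of its $\chi(G)$ color classes. Proposition. For every fixed integer $K\ge 0$ there are an algorithm and a polynomial $p$ such that, for every co-comparability graph $G$ on $n$ vertices with $\chi(G)\le K$, the algorithm, given the adjacency matrix of $G$, computes within $p(n)$ steps a list, without repetitions, of exactly those lists that are types of proper vertex colorings of $G$ with $\chi(G)$ colors. (An algorithm is a program for a random access machine with unit cost whose arithmetic operations are addition and truncated subtraction of natural numbers; polynomial time on this machine is the same as polynomial time on a Turing machine.) -/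

import Mathlib

/-! ### Comparability and co-comparability graphs -/

/-- `r` is a transitive orientation of the edges of `G`: `r x y` says that `xy` is an edge that is
oriented from `x` to `y`. -/
structure IsTransitiveOrientation {V : Type*} (G : SimpleGraph V) (r : V → V → Prop) : Prop where
  adj_of_rel : ∀ x y, r x y → G.Adj x y
  oriented : ∀ x y, G.Adj x y → Xor (r x y) (r y x)
  trans : ∀ x y z, r x y → r y z → r x z

/-- A comparability graph is a graph that has a transitive orientation. -/
def IsComparabilityGraph {V : Type*} (G : SimpleGraph V) : Prop :=
  ∃ r : V → V → Prop, IsTransitiveOrientation G r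

/-- A co-comparability graph is a graph whose complement is a comparability graph. -/
def IsCocomparabilityGraph {V : Type*} (G : SimpleGraph V) : Prop :=
  IsComparabilityGraph Gᶜ

/-! ### Types of colorings -/

/-- The type of a proper vertex coloring with `k` available colors: the list of the `k` sizes of
its color classes (empty classes included), in non-decreasing order. -/
noncomputable def coloringType {V : Type*} {G : SimpleGraph V} {k : ℕ}
    (C : G.Coloring (Fin k)) : List ℕ :=
  ((Finset.univ : Finset (Fin k)).val.map fun i => (C.colorClass i).ncard).sort (· ≤ ·)

/-- `l` is the type of some proper vertex coloring of `G` with `χ(G)` colors. -/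
def IsOptimalColoringType {V : Type*} (G : SimpleGraph V) (l : List ℕ) : Prop :=
  ∃ k : ℕ, G.chromaticNumber = k ∧ ∃ C : G.Coloring (Fin k), coloringType C = l

/-! ### A random access machine with unit cost

The machine has registers, a memory with indirect addressing and an output tape to which it can
only append. All cells hold natural numbers. Addition and (truncated) subtraction are the only
arithmetic operations, so that numbers have at most linearly many bits in the running time and
polynomial time on this machine is polynomial time on a Turing machine. -/

structure RAMState where
  reg : ℕ → ℕ
  mem : ℕ → ℕ
  out : List ℕ

/-- The state with the value of register `d` replaced by `v`. -/
def RAMState.setReg (s : RAMState) (d v : ℕ) : RAMState :=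
  { s with reg := Function.update s.reg d v }

/-- The state with the value of the memory cell at address `a` replaced by `v`. -/
def RAMState.setMem (s : RAMState) (a v : ℕ) : RAMState :=
  { s with mem := Function.update s.mem a v }

/-- The state with `v` appended to the output. -/
def RAMState.emit (s : RAMState) (v : ℕ) : RAMState :=
  { s with out := s.out ++ [v] }

/-- Programs. The arguments `d`, `a`, `b` are names of registers, `c` is a numerical constant. -/
inductive RAMProgram : Type
  /-- `R[d] := c` -/
  | const (d c : ℕ)
  /-- `R[d] := R[a]` -/
  | move (d a : ℕ)
  /-- `R[d] := R[a] + R[b]` -/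
  | add (d a b : ℕ)
  /-- `R[d] := R[a] - R[b]`, or `0` if `R[a] < R[b]` -/
  | sub (d a b : ℕ)
  /-- `R[d] := M[R[a]]` -/
  | load (d a : ℕ)
  /-- `M[R[a]] := R[b]` -/
  | store (a b : ℕ)
  /-- append `R[a]` to the output -/
  | print (a : ℕ)
  /-- run `P`, then `Q` -/
  | seq (P Q : RAMProgram)
  /-- run `P` if `R[a] ≠ 0`, otherwise run `Q` -/
  | branch (a : ℕ) (P Q : RAMProgram)
  /-- run `P` again and again as long as `R[a] ≠ 0` -/
  | loop (a : ℕ) (P : RAMProgram)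

/-- `RAMExec P s s' t`: the program `P`, started in the state `s`, halts in the state `s'` after
exactly `t` steps. Every elementary instruction and every test of a register costs one step. -/
inductive RAMExec : RAMProgram → RAMState → RAMState → ℕ → Prop
  | const (s : RAMState) (d c : ℕ) : RAMExec (.const d c) s (s.setReg d c) 1
  | move (s : RAMState) (d a : ℕ) : RAMExec (.move d a) s (s.setReg d (s.reg a)) 1
  | add (s : RAMState) (d a b : ℕ) :
      RAMExec (.add d a b) s (s.setReg d (s.reg a + s.reg b)) 1
  | sub (s : RAMState) (d a b : ℕ) :
      RAMExec (.sub d a b) s (s.setReg d (s.reg a - s.reg b)) 1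
  | load (s : RAMState) (d a : ℕ) : RAMExec (.load d a) s (s.setReg d (s.mem (s.reg a))) 1
  | store (s : RAMState) (a b : ℕ) : RAMExec (.store a b) s (s.setMem (s.reg a) (s.reg b)) 1
  | print (s : RAMState) (a : ℕ) : RAMExec (.print a) s (s.emit (s.reg a)) 1
  | seq {P Q : RAMProgram} {s s' s'' : RAMState} {t t' : ℕ}
      (hP : RAMExec P s s' t) (hQ : RAMExec Q s' s'' t') : RAMExec (.seq P Q) s s'' (t + t')
  | branch_pos {a : ℕ} {P Q : RAMProgram} {s s' : RAMState} {t : ℕ}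
      (ha : s.reg a ≠ 0) (hP : RAMExec P s s' t) : RAMExec (.branch a P Q) s s' (t + 1)
  | branch_zero {a : ℕ} {P Q : RAMProgram} {s s' : RAMState} {t : ℕ}
      (ha : s.reg a = 0) (hQ : RAMExec Q s s' t) : RAMExec (.branch a P Q) s s' (t + 1)
  | loop_pos {a : ℕ} {P : RAMProgram} {s s' s'' : RAMState} {t t' : ℕ}
      (ha : s.reg a ≠ 0) (hP : RAMExec P s s' t) (hL : RAMExec (.loop a P) s' s'' t') :
      RAMExec (.loop a P) s s'' (t + t' + 1)
  | loop_zero {a : ℕ} {P : RAMProgram} {s : RAMState}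
      (ha : s.reg a = 0) : RAMExec (.loop a P) s s 1

/-- The initial state: the input is in the memory, starting at address `0`; everything else is
zero and the output is empty. -/
def RAMState.init (input : List ℕ) : RAMState where
  reg := fun _ => 0
  mem := fun a => input.getD a 0
  out := []

/-- On the given input, the program halts after at most `T` steps with the given output. -/
def RAMProgram.OutputsWithin (P : RAMProgram) (input output : List ℕ) (T : ℕ) : Prop :=
  ∃ (s : RAMState) (t : ℕ), RAMExec P (RAMState.init input) s t ∧ s.out = output ∧ t ≤ T

/-! ### Input and output format -/

open Classical in
/-- A graph on `n` vertices as an input: the number `n`, followed by the rows of the adjacency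
matrix. -/
noncomputable def encodeGraph {n : ℕ} (G : SimpleGraph (Fin n)) : List ℕ :=
  n :: (List.finRange n).flatMap fun i =>
    (List.finRange n).map fun j => if G.Adj i j then 1 else 0

/-- A list of types as an output: each type is written after its length. -/
def encodeTypes (L : List (List ℕ)) : List ℕ :=
  L.flatMap fun l => l.length :: l

/-! ### Random access machine programs over tables -/

/-- A binary relation `adj` on the numbers below `n`, as the input of a program. -/
structure World where
  n : ℕ
  adj : ℕ → ℕ → Prop

/-- The address of the memory cell for the tuple `l` with entries below `B`. -/
def cellCode (B : ℕ) (l : List ℕ) : ℕ := l.foldl (fun a x => a * B + x) (B * B)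

theorem ofDigits_reverse_eq_foldl (B : ℕ) (l : List ℕ) (a : ℕ) (r : List ℕ) (hr : Nat.ofDigits B r = a) :
    Nat.ofDigits B (l.reverse ++ r) = l.foldl (fun a x => a * B + x) a := by
  induction l generalizing a r with
  | nil => simpa using hr
  | cons x l ih =>
    rw [List.reverse_cons, List.append_assoc, List.foldl_cons]
    apply ih
    simp [Nat.ofDigits_cons, hr]
    ring

theorem cellCode_eq_ofDigits (B : ℕ) (l : List ℕ) :
    Nat.ofDigits B (l.reverse ++ [0, 0, 1]) = cellCode B l :=
  ofDigits_reverse_eq_foldl B l _ _ (by simp [Nat.ofDigits_cons])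

theorem cellCode_injective {B : ℕ} (hB : 1 < B) {l l' : List ℕ} (hl : ∀ x ∈ l, x < B)
    (hl' : ∀ x ∈ l', x < B) (h : cellCode B l = cellCode B l') : l = l' := by
  have key : ∀ m : List ℕ, (∀ x ∈ m, x < B) →
      Nat.digits B (cellCode B m) = m.reverse ++ [0, 0, 1] := by
    intro m hm
    rw [← cellCode_eq_ofDigits]
    refine Nat.digits_ofDigits B hB _ ?_ ?_
    · intro x hx
      simp only [List.mem_append, List.mem_reverse, List.mem_cons, List.not_mem_nil, or_false] at hx
      rcases hx with hx | rfl | rfl | rfl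
      · exact hm x hx
      all_goals omega
    · simp
  have := (key l hl).symm.trans ((congrArg _ h).trans (key l' hl'))
  simpa using this

theorem le_cellCode {B : ℕ} (hB : 1 ≤ B) (l : List ℕ) : B * B ≤ cellCode B l := by
  have key : ∀ (l : List ℕ) (a : ℕ), B * B ≤ a → B * B ≤ l.foldl (fun a x => a * B + x) a := by
    intro l
    induction l with
    | nil => exact fun a h => h
    | cons x l ih =>
      intro a h
      exact ih _ (h.trans ((Nat.le_mul_of_pos_right a hB).trans (Nat.le_add_right _ _)))
  exact key l _ le_rfl

/-- All registers except the temporary ones, the memory and the output agree. -/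
structure RAMState.Frame (s s' : RAMState) : Prop where
  reg : ∀ r, 7 ≤ r ∨ r = 2 ∨ r = 3 → s'.reg r = s.reg r
  mem : s'.mem = s.mem
  out : s'.out = s.out

theorem RAMState.Frame.trans {s s' s'' : RAMState} (h : s.Frame s') (h' : s'.Frame s'') :
    s.Frame s'' :=
  ⟨fun r hr => (h'.reg r hr).trans (h.reg r hr), h'.mem.trans h.mem, h'.out.trans h.out⟩

theorem RAMState.Frame.refl (s : RAMState) : s.Frame s := ⟨fun _ _ => rfl, rfl, rfl⟩

@[simp] theorem RAMState.setReg_reg (s : RAMState) (d v r : ℕ) :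
    (s.setReg d v).reg r = if r = d then v else s.reg r := by
  simp [RAMState.setReg, Function.update_apply]

@[simp] theorem RAMState.setReg_mem (s : RAMState) (d v : ℕ) : (s.setReg d v).mem = s.mem := rfl

@[simp] theorem RAMState.setReg_out (s : RAMState) (d v : ℕ) : (s.setReg d v).out = s.out := rfl

theorem RAMState.Frame.setReg (s : RAMState) {d : ℕ} (v : ℕ) (hd : d < 7 ∧ d ≠ 2 ∧ d ≠ 3) :
    s.Frame (s.setReg d v) := by
  refine ⟨fun r hr => ?_, rfl, rfl⟩
  rw [RAMState.setReg_reg, if_neg (by omega)]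

open Classical in
/-- The truth value of a proposition as a number -/
noncomputable def propBit (p : Prop) : ℕ := if p then 1 else 0

@[simp] theorem propBit_true : propBit True = 1 := if_pos trivial

@[simp] theorem propBit_false : propBit False = 0 := if_neg not_false

/-- The state `s` represents the input `w`, the values `env` of the first `d` variables, the set
`T` of tuples with entries below `w.n + c + 2` and the output `out`. -/
structure Represents (c : ℕ) (w : World) (d : ℕ) (env : ℕ → ℕ) (T : Set (List ℕ)) (out : List ℕ)
    (s : RAMState) : Prop where
  bound : s.reg 2 = w.n + c + 2
  one : s.reg 3 = 1
  var : ∀ i < d, s.reg (i + 7) = env i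
  lt : ∀ i < d, env i < w.n + c + 2
  pos : 0 < d
  size : env 0 = w.n
  input : ∀ i < w.n, ∀ j < w.n, s.mem (1 + (i * w.n + j)) = propBit (w.adj i j)
  table : ∀ l : List ℕ, (∀ x ∈ l, x < w.n + c + 2) →
    s.mem (cellCode (w.n + c + 2) l) = propBit (l ∈ T)
  out : s.out = out

section Programs

variable {c d : ℕ}

theorem Represents.frame {w : World} {env : ℕ → ℕ} {T : Set (List ℕ)} {out : List ℕ}
    {s s' : RAMState} (h : Represents c w d env T out s) (hs : s.Frame s') : Represents c w d env T out s' where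
  bound := (hs.reg 2 (by omega)).trans h.bound
  one := (hs.reg 3 (by omega)).trans h.one
  var i hi := (hs.reg _ (by omega)).trans (h.var i hi)
  lt := h.lt
  pos := h.pos
  size := h.size
  input := by rw [hs.mem]; exact h.input
  table := by rw [hs.mem]; exact h.table
  out := hs.out.trans h.out

theorem Represents.setVar {w : World} {env : ℕ → ℕ} {T : Set (List ℕ)} {out : List ℕ}
    {s : RAMState} (h : Represents c w d env T out s) (v : ℕ) : Represents c w d env T out (s.setReg (d + 7) v) where
  bound := by rw [RAMState.setReg_reg, if_neg (by omega), h.bound]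
  one := by rw [RAMState.setReg_reg, if_neg (by omega), h.one]
  var i hi := by rw [RAMState.setReg_reg, if_neg (by omega), h.var i hi]
  lt := h.lt
  pos := h.pos
  size := h.size
  input := h.input
  table := h.table
  out := h.out

theorem Represents.extend {w : World} {env : ℕ → ℕ} {T : Set (List ℕ)} {out : List ℕ}
    {s : RAMState} (h : Represents c w d env T out s) {v : ℕ} (hv : s.reg (d + 7) = v)
    (hvb : v < w.n + c + 2) : Represents c w (d + 1) (Function.update env d v) T out s where
  bound := h.bound
  one := h.one
  var i hi := by
    rcases Nat.lt_succ_iff_lt_or_eq.1 hi with hi | rfl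
    · rw [h.var i hi, Function.update_of_ne hi.ne]
    · rw [hv, Function.update_self]
  lt i hi := by
    rcases Nat.lt_succ_iff_lt_or_eq.1 hi with hi | rfl
    · rw [Function.update_of_ne hi.ne]; exact h.lt i hi
    · rwa [Function.update_self]
  pos := Nat.succ_pos d
  size := by rw [Function.update_of_ne h.pos.ne]; exact h.size
  input := h.input
  table := h.table
  out := h.out

theorem Represents.restrict {w : World} {env : ℕ → ℕ} {T : Set (List ℕ)} {out : List ℕ}
    {s : RAMState} {v : ℕ} (hd : 0 < d)
    (h : Represents c w (d + 1) (Function.update env d v) T out s) : Represents c w d env T out s where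
  bound := h.bound
  one := h.one
  var i hi := by rw [h.var i (by omega), Function.update_of_ne hi.ne]
  lt i hi := by have := h.lt i (by omega); rwa [Function.update_of_ne hi.ne] at this
  pos := hd
  size := by have := h.size; rwa [Function.update_of_ne hd.ne] at this
  input := h.input
  table := h.table
  out := h.out

/-- The predicate `φ` of the first `d` variables and the table can be decided in polynomial
time. -/
def Dec (c d : ℕ) (φ : World → (ℕ → ℕ) → Set (List ℕ) → Prop) : Prop :=
  ∃ (P : RAMProgram) (p : Polynomial ℕ), ∀ (w : World) (env : ℕ → ℕ) (T : Set (List ℕ))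
    (out : List ℕ) (s : RAMState), Represents c w d env T out s →
      ∃ (s' : RAMState) (t : ℕ), RAMExec P s s' t ∧ Represents c w d env T out s' ∧
        s'.reg 0 = propBit (φ w env T) ∧ t ≤ p.eval w.n

/-- The transformation `F` of the table and the output, depending on the first `d` variables, can
be carried out in polynomial time. -/
def Cmd (c d : ℕ)
    (F : World → (ℕ → ℕ) → Set (List ℕ) × List ℕ → Set (List ℕ) × List ℕ) : Prop :=
  ∃ (P : RAMProgram) (p : Polynomial ℕ), ∀ (w : World) (env : ℕ → ℕ) (T : Set (List ℕ))
    (out : List ℕ) (s : RAMState), Represents c w d env T out s →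
      ∃ (s' : RAMState) (t : ℕ), RAMExec P s s' t ∧
        Represents c w d env (F w env (T, out)).1 (F w env (T, out)).2 s' ∧ t ≤ p.eval w.n

/-! #### Predicates -/

variable {φ ψ : World → (ℕ → ℕ) → Set (List ℕ) → Prop}

theorem Dec.const_true : Dec c d fun _ _ _ => True := by
  refine ⟨.const 0 1, 1, fun w env T out s h => ?_⟩
  exact ⟨_, _, .const s 0 1, h.frame (.setReg s 1 (by omega)), by simp, by simp⟩

theorem Dec.not (h : Dec c d φ) : Dec c d fun w env T => ¬ φ w env T := by
  obtain ⟨P, p, hP⟩ := h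
  refine ⟨.seq P (.branch 0 (.const 0 0) (.const 0 1)), p + 2, fun w env T out s h => ?_⟩
  obtain ⟨s', t, e, h', r, ht⟩ := hP w env T out s h
  by_cases hφ : φ w env T
  · refine ⟨_, _, .seq e (.branch_pos (by simp [r, hφ]) (.const _ _ _)),
      h'.frame (.setReg s' _ (by omega)), by simp [hφ], by simpa using ht⟩
  · refine ⟨_, _, .seq e (.branch_zero (by simp [r, hφ]) (.const _ _ _)),
      h'.frame (.setReg s' _ (by omega)), by simp [hφ], by simpa using ht⟩

theorem Dec.and (h : Dec c d φ) (h' : Dec c d ψ) :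
    Dec c d fun w env T => φ w env T ∧ ψ w env T := by
  obtain ⟨P, p, hP⟩ := h
  obtain ⟨Q, q, hQ⟩ := h'
  refine ⟨.seq P (.branch 0 Q (.const 0 0)), p + q + 2, fun w env T out s h => ?_⟩
  obtain ⟨s', t, e, h', r, ht⟩ := hP w env T out s h
  by_cases hφ : φ w env T
  · obtain ⟨s'', t', e', h'', r', ht'⟩ := hQ w env T out s' h'
    refine ⟨_, _, .seq e (.branch_pos (by simp [r, hφ]) e'), h'', by simp [r', hφ], ?_⟩
    simp; omega
  · refine ⟨_, _, .seq e (.branch_zero (by simp [r, hφ]) (.const _ _ _)),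
      h'.frame (.setReg s' _ (by omega)), by simp [hφ], ?_⟩
    simp; omega

theorem Dec.congr (h : Dec c d φ) (h' : ∀ w env T, ψ w env T ↔ φ w env T) : Dec c d ψ := by
  have : ψ = φ := by funext w env T; exact propext (h' w env T)
  rwa [this]

theorem Dec.or (h : Dec c d φ) (h' : Dec c d ψ) :
    Dec c d fun w env T => φ w env T ∨ ψ w env T :=
  (h.not.and h'.not).not.congr fun _ _ _ => by tauto

theorem Dec.imp (h : Dec c d φ) (h' : Dec c d ψ) :
    Dec c d fun w env T => φ w env T → ψ w env T :=
  (h.and h'.not).not.congr fun _ _ _ => by tauto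

theorem Dec.exFin {k : ℕ} {φ : ℕ → World → (ℕ → ℕ) → Set (List ℕ) → Prop}
    (h : ∀ j < k, Dec c d (φ j)) : Dec c d fun w env T => ∃ j < k, φ j w env T := by
  induction k with
  | zero => exact Dec.const_true.not.congr (by simp)
  | succ k ih =>
    refine ((ih fun j hj => h j (by omega)).or (h k (by omega))).congr fun w env T => ?_
    simp only [Nat.lt_succ_iff_lt_or_eq]
    grind

theorem Dec.allFin {k : ℕ} {φ : ℕ → World → (ℕ → ℕ) → Set (List ℕ) → Prop}
    (h : ∀ j < k, Dec c d (φ j)) : Dec c d fun w env T => ∀ j < k, φ j w env T :=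
  (Dec.exFin fun j hj => (h j hj).not).not.congr fun _ _ _ => by simp

theorem Dec.var_lt {x y : ℕ} (hx : x < d) (hy : y < d) : Dec c d fun _ env _ => env x < env y := by
  refine ⟨.seq (.sub 0 (y + 7) (x + 7)) (.branch 0 (.const 0 1) (.const 0 0)), 3,
    fun w env T out s h => ?_⟩
  by_cases hxy : env x < env y
  · refine ⟨_, _, .seq (.sub _ _ _ _) (.branch_pos ?_ (.const _ _ _)),
      (h.frame (.setReg _ _ (by omega))).frame (.setReg _ _ (by omega)), by simp [hxy], by simp⟩
    simp [h.var x hx, h.var y hy]; omega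
  · refine ⟨_, _, .seq (.sub _ _ _ _) (.branch_zero ?_ (.const _ _ _)),
      (h.frame (.setReg _ _ (by omega))).frame (.setReg _ _ (by omega)), by simp [hxy], by simp⟩
    simp [h.var x hx, h.var y hy]; omega

theorem Dec.var_eq {x y : ℕ} (hx : x < d) (hy : y < d) : Dec c d fun _ env _ => env x = env y :=
  ((Dec.var_lt hx hy).not.and (Dec.var_lt hy hx).not).congr fun _ _ _ => by omega

theorem Dec.var_le {x y : ℕ} (hx : x < d) (hy : y < d) : Dec c d fun _ env _ => env x ≤ env y :=
  (Dec.var_lt hy hx).not.congr fun _ _ _ => by omega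

theorem Dec.var_succ_lt {x y : ℕ} (hx : x < d) (hy : y < d) :
    Dec c d fun _ env _ => env x + 1 < env y := by
  refine ⟨.seq (.sub 0 (y + 7) (x + 7)) (.seq (.sub 0 0 3)
    (.branch 0 (.const 0 1) (.const 0 0))), 4, fun w env T out s h => ?_⟩
  by_cases hxy : env x + 1 < env y
  · refine ⟨_, _, .seq (.sub _ _ _ _) (.seq (.sub _ _ _ _) (.branch_pos ?_ (.const _ _ _))),
      ((h.frame (.setReg _ _ (by omega))).frame (.setReg _ _ (by omega))).frame
        (.setReg _ _ (by omega)), by simp [hxy], by simp⟩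
    simp [h.var x hx, h.var y hy, h.one]; omega
  · refine ⟨_, _, .seq (.sub _ _ _ _) (.seq (.sub _ _ _ _) (.branch_zero ?_ (.const _ _ _))),
      ((h.frame (.setReg _ _ (by omega))).frame (.setReg _ _ (by omega))).frame
        (.setReg _ _ (by omega)), by simp [hxy], by simp⟩
    simp [h.var x hx, h.var y hy, h.one]; omega

theorem Dec.var_succ_eq {x y : ℕ} (hx : x < d) (hy : y < d) :
    Dec c d fun _ env _ => env x + 1 = env y :=
  ((Dec.var_lt hx hy).and (Dec.var_succ_lt hx hy).not).congr fun _ _ _ => by omega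

theorem Dec.var_lt_size {x : ℕ} (hx : x < d) : Dec c d fun w env _ => env x < w.n := by
  obtain ⟨P, p, hP⟩ := Dec.var_lt (c := c) hx (Nat.zero_lt_of_lt hx)
  refine ⟨P, p, fun w env T out s h => ?_⟩
  simpa only [h.size] using hP w env T out s h

theorem Dec.var_eq_size {x : ℕ} (hx : x < d) : Dec c d fun w env _ => env x = w.n := by
  obtain ⟨P, p, hP⟩ := Dec.var_eq (c := c) hx (Nat.zero_lt_of_lt hx)
  refine ⟨P, p, fun w env T out s h => ?_⟩
  simpa only [h.size] using hP w env T out s h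

/-- `R[4] := R[4] * R[b] + R[x]` -/
def hornerStep (b x : ℕ) : RAMProgram :=
  .seq (.move 5 b) (.seq (.const 6 0)
    (.seq (.loop 5 (.seq (.add 6 6 4) (.sub 5 5 3))) (.add 4 6 x)))

theorem exec_mul_loop (m : ℕ) : ∀ s : RAMState, s.reg 5 = m → s.reg 3 = 1 →
    ∃ s', RAMExec (.loop 5 (.seq (.add 6 6 4) (.sub 5 5 3))) s s' (3 * m + 1) ∧ s.Frame s' ∧
      s'.reg 6 = s.reg 6 + m * s.reg 4 ∧ s'.reg 0 = s.reg 0 := by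
  induction m with
  | zero => exact fun s h5 _ => ⟨s, .loop_zero h5, .refl s, by simp, rfl⟩
  | succ m ih =>
    intro s h5 h3
    obtain ⟨s', e, f, h6, h0⟩ := ih ((s.setReg 6 (s.reg 6 + s.reg 4)).setReg 5 m) (by simp) (by simpa)
    refine ⟨s', ?_, ((RAMState.Frame.setReg s _ (by omega)).trans
      (.setReg _ _ (by omega))).trans f, ?_, by simpa using h0⟩
    · have e1 := RAMExec.seq (.add s 6 6 4) (.sub (s.setReg 6 (s.reg 6 + s.reg 4)) 5 5 3)
      have e2 : (s.setReg 6 (s.reg 6 + s.reg 4)).reg 5 - (s.setReg 6 (s.reg 6 + s.reg 4)).reg 3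
          = m := by simp [h5, h3]
      rw [e2] at e1
      have := RAMExec.loop_pos (a := 5) (by omega) e1 e
      convert this using 1
      ring
    · rw [h6]; simp; ring

theorem exec_hornerStep (s : RAMState) {b x : ℕ} (hx : 7 ≤ x ∨ x = 0)
    (h3 : s.reg 3 = 1) :
    ∃ s', RAMExec (hornerStep b x) s s' (3 * s.reg b + 4) ∧ s.Frame s' ∧
      s'.reg 4 = s.reg 4 * s.reg b + s.reg x ∧ s'.reg 0 = s.reg 0 := by
  obtain ⟨s', e, f, h6, h0⟩ := exec_mul_loop (s.reg b) ((s.setReg 5 (s.reg b)).setReg 6 0)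
    (by simp) (by simpa)
  have f0 : s.Frame s' := ((RAMState.Frame.setReg s _ (by omega)).trans (.setReg _ _ (by omega))).trans f
  refine ⟨_, ?_, f0.trans (.setReg s' (s'.reg 6 + s'.reg x) (by omega : 4 < 7 ∧ _)), ?_, ?_⟩
  · have := RAMExec.seq (.move s 5 b) (.seq (.const _ 6 0) (.seq e (.add s' 4 6 x)))
    rw [hornerStep]
    convert this using 1
    ring
  · have hxe : s'.reg x = s.reg x := by
      rcases hx with hx | rfl
      · exact f0.reg x (.inl hx)
      · simpa using h0
    simp [h6, hxe]; ring
  · simpa using h0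

/-- `R[4] := R[4] * R[2] + R[x + 7]` for all `x` in the list, one after the other -/
def hornerVars : List ℕ → RAMProgram
  | [] => .const 5 0
  | x :: l => .seq (hornerStep 2 (x + 7)) (hornerVars l)

theorem exec_hornerVars (l : List ℕ) : ∀ s : RAMState, s.reg 3 = 1 →
    ∃ s', RAMExec (hornerVars l) s s' (l.length * (3 * s.reg 2 + 4) + 1) ∧ s.Frame s' ∧
      s'.reg 4 = (l.map fun x => s.reg (x + 7)).foldl (fun a x => a * s.reg 2 + x) (s.reg 4) := by
  induction l with
  | nil =>
    intro s _
    exact ⟨_, by simpa [hornerVars] using RAMExec.const s 5 0, .setReg s 0 (by omega), by simp⟩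
  | cons x l ih =>
    intro s h3
    obtain ⟨s1, e1, f1, h1, _⟩ := exec_hornerStep s (b := 2) (x := x + 7) (by omega) h3
    obtain ⟨s2, e2, f2, h2⟩ := ih s1 ((f1.reg 3 (by omega)).trans h3)
    refine ⟨s2, ?_, f1.trans f2, ?_⟩
    · have := RAMExec.seq e1 e2
      rw [f1.reg 2 (by omega)] at this
      rw [hornerVars]
      convert this using 1
      simp; ring
    · have hr : ∀ x, s1.reg (x + 7) = s.reg (x + 7) := fun x => f1.reg _ (by omega)
      rw [h2, h1, f1.reg 2 (by omega)]
      simp [hr]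

/-- Compute in `R[4]` the address of the tuple consisting of `a` and the values of the variables
in `l`. -/
def addressOf (a : ℕ) (l : List ℕ) : RAMProgram :=
  .seq (.const 0 0) (.seq (.move 4 2) (.seq (hornerStep 2 0) (.seq (.const 0 a)
    (.seq (hornerStep 2 0) (hornerVars l)))))

theorem exec_addressOf (a : ℕ) (l : List ℕ) (hl : ∀ x ∈ l, x < d) {w : World} {env : ℕ → ℕ}
    {T : Set (List ℕ)} {out : List ℕ} {s : RAMState} (h : Represents c w d env T out s) :
    ∃ s', RAMExec (addressOf a l) s s' ((l.length + 2) * (3 * (w.n + c + 2) + 4) + 4) ∧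
      s.Frame s' ∧ s'.reg 4 = cellCode (w.n + c + 2) (a :: l.map env) := by
  set B := w.n + c + 2 with hB
  have hs := h.bound
  rw [← hB] at hs
  obtain ⟨s1, e1, f1, h1, -⟩ := exec_hornerStep ((s.setReg 0 0).setReg 4 B) (b := 2) (x := 0)
    (by omega) (by simpa using h.one)
  have g1 : s.Frame s1 := ((RAMState.Frame.setReg s _ (by omega)).trans
    (.setReg _ _ (by omega))).trans f1
  obtain ⟨s2, e2, f2, h2, -⟩ := exec_hornerStep (s1.setReg 0 a) (b := 2) (x := 0)
    (by omega) (by simpa using (g1.reg 3 (by omega)).trans h.one)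
  have g2 : s.Frame s2 := g1.trans ((RAMState.Frame.setReg s1 a (by omega)).trans f2)
  obtain ⟨s3, e3, f3, h3⟩ := exec_hornerVars l s2 ((g2.reg 3 (by omega)).trans h.one)
  refine ⟨s3, ?_, g2.trans f3, ?_⟩
  · have m := RAMExec.move (s.setReg 0 0) 4 2
    have hm : (s.setReg 0 0).reg 2 = B := by simpa using hs
    rw [hm] at m
    have := RAMExec.seq (.const s 0 0) (.seq m (.seq e1 (.seq (.const s1 0 a) (.seq e2 e3))))
    rw [addressOf]
    convert this using 1
    rw [g2.reg 2 (by omega)]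
    simp [hs, (g1.reg 2 (by omega)).trans hs]
    ring
  · have hm : (l.map fun x => s2.reg (x + 7)) = l.map env :=
      List.map_congr_left fun x hx => (g2.reg _ (by omega)).trans (h.var x (hl x hx))
    rw [h3, hm, g2.reg 2 (by omega), hs, h2]
    simp [cellCode, h1, (g1.reg 2 (by omega)).trans hs, hs]

theorem Dec.mem_table (a : ℕ) (l : List ℕ) (ha : a < c + 2) (hl : ∀ x ∈ l, x < d) :
    Dec c d fun _ env T => a :: l.map env ∈ T := by
  refine ⟨.seq (addressOf a l) (.load 0 4), (Polynomial.C (l.length + 2)) *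
    (3 * (Polynomial.X + Polynomial.C (c + 2)) + 4) + 5, fun w env T out s h => ?_⟩
  obtain ⟨s', e, f, r⟩ := exec_addressOf a l hl h
  refine ⟨_, _, .seq e (.load s' 0 4), h.frame (f.trans (.setReg _ _ (by omega))), ?_, ?_⟩
  · rw [RAMState.setReg_reg, if_pos rfl, r, f.mem]
    apply h.table
    intro x hx
    rcases List.mem_cons.1 hx with rfl | hx
    · omega
    · obtain ⟨y, hy, rfl⟩ := List.mem_map.1 hx
      exact h.lt y (hl y hy)
  · simp only [Polynomial.eval_add, Polynomial.eval_mul, Polynomial.eval_C, Polynomial.eval_X,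
      Polynomial.eval_ofNat]
    apply le_of_eq
    ring

theorem Dec.adj {x y : ℕ} (hx : x < d) (hy : y < d) :
    Dec c d fun w env _ => env x < w.n ∧ env y < w.n ∧ w.adj (env x) (env y) := by
  have h0 : 0 < d := Nat.zero_lt_of_lt hx
  obtain ⟨P, p, hP⟩ := (Dec.var_lt_size (c := c) hx).and (Dec.var_lt_size (c := c) hy)
  refine ⟨.seq P (.branch 0 (.seq (.move 4 (x + 7)) (.seq (hornerStep 7 (y + 7))
    (.seq (.add 4 3 4) (.load 0 4)))) (.const 0 0)), p + 3 * Polynomial.X + 8,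
    fun w env T out s h => ?_⟩
  obtain ⟨s', t, e, h', r, ht⟩ := hP w env T out s h
  by_cases hxy : env x < w.n ∧ env y < w.n
  · obtain ⟨s1, e1, f1, r1, -⟩ := exec_hornerStep (s'.setReg 4 (s'.reg (x + 7)))
      (b := 7) (x := y + 7) (by omega) (by simpa using h'.one)
    have f2 : s'.Frame s1 := (RAMState.Frame.setReg s' _ (by omega)).trans f1
    have h1 := h'.frame f2
    have hn : s'.reg 7 = w.n := (h'.var 0 h0).trans h'.size
    refine ⟨_, _, .seq e (.branch_pos (by simp [r, hxy]) (.seq (.move _ _ _)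
      (.seq e1 (.seq (.add _ _ _ _) (.load _ _ _))))),
      h1.frame ((RAMState.Frame.setReg s1 _ (by omega)).trans (.setReg _ _ (by omega))), ?_, ?_⟩
    · have := h1.input _ hxy.1 _ hxy.2
      simp only [hxy, true_and]
      simp [r1, h1.one, hn, h'.var x hx, h'.var y hy, this]
    · simp [hn]; omega
  · refine ⟨_, _, .seq e (.branch_zero (by simp [r, hxy]) (.const _ _ _)),
      h'.frame (.setReg s' _ (by omega)), ?_, ?_⟩
    · have : ¬ (env x < w.n ∧ env y < w.n ∧ w.adj (env x) (env y)) := by tauto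
      simp [this]
    · simp; omega

theorem Dec.ex (h : Dec c (d + 1) φ) :
    Dec c d fun w env T => ∃ v < w.n + c + 2, φ w (Function.update env d v) T := by
  obtain ⟨P, p, hP⟩ := h
  refine ⟨.seq (.const 0 0) (.seq (.const (d + 7) 0) (.seq (.move 1 2) (.loop 1 (.seq P (.branch 0
    (.const 1 0) (.seq (.add (d + 7) (d + 7) 3) (.sub 1 2 (d + 7)))))))),
    3 + (Polynomial.X + Polynomial.C (c + 2)) * (p + 4) + 2, fun w env T out s h => ?_⟩
  have key : ∀ (m v : ℕ) (s : RAMState), v + m = w.n + c + 2 → Represents c w d env T out s →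
      s.reg (d + 7) = v → s.reg 1 = m → s.reg 0 = 0 →
      ∃ s' t, RAMExec (.loop 1 (.seq P (.branch 0
        (.const 1 0) (.seq (.add (d + 7) (d + 7) 3) (.sub 1 2 (d + 7)))))) s s' t ∧
        Represents c w d env T out s' ∧ s'.reg 0 = propBit (∃ u, v ≤ u ∧ u < w.n + c + 2 ∧
          φ w (Function.update env d u) T) ∧ t ≤ m * (p.eval w.n + 4) + 2 := by
    intro m
    induction m with
    | zero =>
      intro v s hv h hd h1 h0
      refine ⟨s, _, .loop_zero h1, h, ?_, by simp⟩
      have : ¬ ∃ u, v ≤ u ∧ u < w.n + c + 2 ∧ φ w (Function.update env d u) T := by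
        rintro ⟨u, hu, hu', -⟩
        omega
      rw [h0, eq_false this, propBit_false]
    | succ m ih =>
      intro v s hv h hd h1 h0
      obtain ⟨s1, t1, e1, h1', r1, ht1⟩ := hP w _ T out s (h.extend hd (by omega))
      have hv1 : s1.reg (d + 7) = v := by rw [h1'.var d (by omega), Function.update_self]
      have h2 := h1'.restrict h.pos
      by_cases hφ : φ w (Function.update env d v) T
      · refine ⟨_, _, .loop_pos (by omega) (.seq e1 (.branch_pos (by simp [r1, hφ])
          (.const _ _ _))) (.loop_zero (by simp)), h2.frame (.setReg _ _ (by omega)), ?_, ?_⟩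
        · have : ∃ u, v ≤ u ∧ u < w.n + c + 2 ∧ φ w (Function.update env d u) T :=
            ⟨v, le_rfl, by omega, hφ⟩
          rw [RAMState.setReg_reg, if_neg (by omega), r1, eq_true hφ, eq_true this]
        · rw [Nat.succ_mul]; omega
      · have hr : ((s1.setReg (d + 7) (v + 1)).setReg 1 m).reg 0 = 0 := by simp [r1, hφ]
        obtain ⟨s2, t2, e2, h2', r2, ht2⟩ := ih (v + 1) ((s1.setReg (d + 7) (v + 1)).setReg 1 m)
          (by omega) ((h2.setVar _).frame (.setReg _ _ (by omega))) (by simp) (by simp) hr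
        have he : (s1.setReg (d + 7) (v + 1)).setReg 1 m =
            (s1.setReg (d + 7) (s1.reg (d + 7) + s1.reg 3)).setReg 1
              ((s1.setReg (d + 7) (s1.reg (d + 7) + s1.reg 3)).reg 2 -
                (s1.setReg (d + 7) (s1.reg (d + 7) + s1.reg 3)).reg (d + 7)) := by
          congr 1
          · simp [hv1, h2.one]
          · simp [hv1, h2.one, h2.bound]; omega
        refine ⟨s2, _, .loop_pos (by omega) (.seq e1 (.branch_zero (by simp [r1, hφ])
          (.seq (.add _ _ _ _) (.sub _ _ _ _)))) (he ▸ e2), h2', ?_, ?_⟩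
        · rw [r2]
          congr 1
          apply propext
          constructor
          · rintro ⟨u, hu, hu'⟩
            exact ⟨u, by omega, hu'⟩
          · rintro ⟨u, hu, hu', hu''⟩
            refine ⟨u, ?_, hu', hu''⟩
            rcases hu.eq_or_lt with rfl | hu
            · exact absurd hu'' hφ
            · omega
        · rw [Nat.succ_mul]; omega
  obtain ⟨s', t, e, h', r, ht⟩ := key (w.n + c + 2) 0
    (((s.setReg 0 0).setReg (d + 7) 0).setReg 1 (w.n + c + 2)) (by omega)
    (((h.frame (.setReg _ _ (by omega))).setVar _).frame (.setReg _ _ (by omega)))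
    (by simp) (by simp) (by simp)
  have he : ((s.setReg 0 0).setReg (d + 7) 0).setReg 1 (w.n + c + 2) =
      ((s.setReg 0 0).setReg (d + 7) 0).setReg 1
        (((s.setReg 0 0).setReg (d + 7) 0).reg 2) := by simp [h.bound]
  refine ⟨s', _, .seq (.const _ _ _) (.seq (.const _ _ _) (.seq (.move _ _ _) (he ▸ e))), h', ?_, ?_⟩
  · simpa using r
  · simp only [Polynomial.eval_add, Polynomial.eval_mul, Polynomial.eval_C, Polynomial.eval_X,
      Polynomial.eval_ofNat, ← add_assoc]
    omega

theorem Dec.all (h : Dec c (d + 1) φ) :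
    Dec c d fun w env T => ∀ v < w.n + c + 2, φ w (Function.update env d v) T :=
  h.not.ex.not.congr fun _ _ _ => by simp

/-! #### Commands -/

variable {F F' : World → (ℕ → ℕ) → Set (List ℕ) × List ℕ → Set (List ℕ) × List ℕ}

theorem Cmd.skip : Cmd c d fun _ _ σ => σ :=
  ⟨.const 0 0, 1, fun _ _ _ _ s h =>
    ⟨_, _, .const s 0 0, h.frame (.setReg _ _ (by omega)), by simp⟩⟩

theorem Cmd.seq (h : Cmd c d F) (h' : Cmd c d F') :
    Cmd c d fun w env σ => F' w env (F w env σ) := by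
  obtain ⟨P, p, hP⟩ := h
  obtain ⟨Q, q, hQ⟩ := h'
  refine ⟨.seq P Q, p + q, fun w env T out s h => ?_⟩
  obtain ⟨s', t, e, h', ht⟩ := hP w env T out s h
  obtain ⟨s'', t', e', h'', ht'⟩ := hQ w env _ _ s' h'
  exact ⟨_, _, .seq e e', h'', by simp; omega⟩

open Classical in
theorem Cmd.ite (hφ : Dec c d φ) (h : Cmd c d F) (h' : Cmd c d F') :
    Cmd c d fun w env σ => if φ w env σ.1 then F w env σ else F' w env σ := by
  obtain ⟨R, r, hR⟩ := hφ
  obtain ⟨P, p, hP⟩ := h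
  obtain ⟨Q, q, hQ⟩ := h'
  refine ⟨.seq R (.branch 0 P Q), r + p + q + 1, fun w env T out s h => ?_⟩
  obtain ⟨s', t, e, h', hr, ht⟩ := hR w env T out s h
  by_cases hc : φ w env T
  · obtain ⟨s'', t', e', h'', ht'⟩ := hP w env _ _ s' h'
    exact ⟨_, _, .seq e (.branch_pos (by simp [hr, hc]) e'), by simpa [hc] using h'', by simp; omega⟩
  · obtain ⟨s'', t', e', h'', ht'⟩ := hQ w env _ _ s' h'
    exact ⟨_, _, .seq e (.branch_zero (by simp [hr, hc]) e'), by simpa [hc] using h'', by simp; omega⟩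

theorem Cmd.print_var {x : ℕ} (hx : x < d) : Cmd c d fun _ env σ => (σ.1, σ.2 ++ [env x]) := by
  refine ⟨.print (x + 7), 1, fun w env T out s h => ⟨_, _, .print s _, ?_, by simp⟩⟩
  exact ⟨h.bound, h.one, h.var, h.lt, h.pos, h.size, h.input, h.table, by
    simp [RAMState.emit, h.out, h.var x hx]⟩

theorem Cmd.print_const (k : ℕ) : Cmd c d fun _ _ σ => (σ.1, σ.2 ++ [k]) := by
  refine ⟨.seq (.const 0 k) (.print 0), 2, fun w env T out s h =>
    ⟨_, _, .seq (.const s 0 k) (.print _ _), ?_, by simp⟩⟩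
  have h := h.frame (.setReg s k (by omega : 0 < 7 ∧ _))
  exact ⟨h.bound, h.one, h.var, h.lt, h.pos, h.size, h.input, h.table, by
    simp [RAMState.emit, ← h.out]⟩

theorem Cmd.insertTuple (a : ℕ) (l : List ℕ) (ha : a < c + 2) (hl : ∀ x ∈ l, x < d) :
    Cmd c d fun _ env σ => (insert (a :: l.map env) σ.1, σ.2) := by
  refine ⟨.seq (addressOf a l) (.store 4 3), (Polynomial.C (l.length + 2)) *
    (3 * (Polynomial.X + Polynomial.C (c + 2)) + 4) + 5, fun w env T out s h => ?_⟩
  obtain ⟨s', e, f, r⟩ := exec_addressOf a l hl h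
  have h' := h.frame f
  refine ⟨_, _, .seq e (.store s' 4 3), ⟨h'.bound, h'.one, h'.var, h'.lt, h'.pos, h'.size,
    ?_, ?_, h'.out⟩, ?_⟩
  · intro i hi j hj
    have hc := le_cellCode (B := w.n + c + 2) (by omega) (a :: l.map env)
    have hlt : 1 + (i * w.n + j) < cellCode (w.n + c + 2) (a :: l.map env) := by
      have : (i + 1) * w.n ≤ w.n * w.n := Nat.mul_le_mul_right _ hi
      nlinarith
    simp only [RAMState.setMem, r]
    rw [Function.update_of_ne hlt.ne]
    exact h'.input i hi j hj
  · intro m hm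
    simp only [RAMState.setMem, r, h'.one]
    by_cases hml : m = a :: l.map env
    · simp [hml]
    · rw [Function.update_of_ne, h'.table m hm]
      · simp [hml]
      · intro hc
        refine hml (cellCode_injective (by omega) hm ?_ hc)
        intro x hx
        rcases List.mem_cons.1 hx with rfl | hx
        · omega
        · obtain ⟨y, hy, rfl⟩ := List.mem_map.1 hx
          exact h.lt y (hl y hy)
  · simp only [Polynomial.eval_add, Polynomial.eval_mul, Polynomial.eval_C, Polynomial.eval_X,
      Polynomial.eval_ofNat]
    apply le_of_eq
    ring

theorem Cmd.forAll (h : Cmd c (d + 1) F) : Cmd c d fun w env σ =>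
    (List.range (w.n + c + 2)).foldl (fun σ v => F w (Function.update env d v) σ) σ := by
  obtain ⟨P, p, hP⟩ := h
  refine ⟨.seq (.const (d + 7) 0) (.seq (.move 1 2) (.loop 1 (.seq P
    (.seq (.add (d + 7) (d + 7) 3) (.sub 1 2 (d + 7)))))),
    2 + (Polynomial.X + Polynomial.C (c + 2)) * (p + 3) + 1, fun w env T out s h => ?_⟩
  have key : ∀ (m v : ℕ) (σ : Set (List ℕ) × List ℕ) (s : RAMState), v + m = w.n + c + 2 →
      Represents c w d env σ.1 σ.2 s → s.reg (d + 7) = v → s.reg 1 = m →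
      ∃ s' t, RAMExec (.loop 1 (.seq P (.seq (.add (d + 7) (d + 7) 3) (.sub 1 2 (d + 7))))) s s' t ∧
        Represents c w d env
          ((List.range' v m).foldl (fun σ v => F w (Function.update env d v) σ) σ).1
          ((List.range' v m).foldl (fun σ v => F w (Function.update env d v) σ) σ).2 s' ∧
        t ≤ m * (p.eval w.n + 3) + 1 := by
    intro m
    induction m with
    | zero => exact fun v σ s hv h hd h1 => ⟨s, _, .loop_zero h1, h, by simp⟩
    | succ m ih =>
      intro v σ s hv h hd h1
      obtain ⟨s1, t1, e1, h1', ht1⟩ := hP w _ _ _ s (h.extend hd (by omega))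
      have hv1 : s1.reg (d + 7) = v := by rw [h1'.var d (by omega), Function.update_self]
      have h2 := h1'.restrict h.pos
      obtain ⟨s2, t2, e2, h2', ht2⟩ := ih (v + 1) (F w (Function.update env d v) σ)
        ((s1.setReg (d + 7) (v + 1)).setReg 1 m)
        (by omega) ((h2.setVar _).frame (.setReg _ _ (by omega))) (by simp) (by simp)
      have he : (s1.setReg (d + 7) (v + 1)).setReg 1 m =
          (s1.setReg (d + 7) (s1.reg (d + 7) + s1.reg 3)).setReg 1
            ((s1.setReg (d + 7) (s1.reg (d + 7) + s1.reg 3)).reg 2 -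
              (s1.setReg (d + 7) (s1.reg (d + 7) + s1.reg 3)).reg (d + 7)) := by
        congr 1
        · simp [hv1, h2.one]
        · simp [hv1, h2.one, h2.bound]; omega
      refine ⟨s2, _, .loop_pos (by omega) (.seq e1 (.seq (.add _ _ _ _) (.sub _ _ _ _))) (he ▸ e2),
        by simpa [List.range'_succ] using h2', ?_⟩
      rw [Nat.succ_mul]; omega
  obtain ⟨s', t, e, h', ht⟩ := key (w.n + c + 2) 0 (T, out)
    ((s.setReg (d + 7) 0).setReg 1 (w.n + c + 2)) (by omega)
    ((h.setVar _).frame (.setReg _ _ (by omega))) (by simp) (by simp)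
  have he : (s.setReg (d + 7) 0).setReg 1 (w.n + c + 2) =
      (s.setReg (d + 7) 0).setReg 1 ((s.setReg (d + 7) 0).reg 2) := by simp [h.bound]
  refine ⟨s', _, .seq (.const _ _ _) (.seq (.move _ _ _) (he ▸ e)), ?_, ?_⟩
  · simpa only [List.range_eq_range'] using h'
  · simp only [Polynomial.eval_add, Polynomial.eval_mul, Polynomial.eval_C, Polynomial.eval_X,
      Polynomial.eval_ofNat, Polynomial.eval_one, ← add_assoc]
    omega

end Programs

/-! ### Nested loops and closures -/

/-- The list of all tuples of length `m` with entries below `B`. -/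
def tuples (B : ℕ) : ℕ → List (List ℕ)
  | 0 => [[]]
  | m + 1 => (List.range B).flatMap fun v => (tuples B m).map (v :: ·)

/-- Assign the entries of `y` to the variables from number `d` on. -/
def assign (env : ℕ → ℕ) (d : ℕ) : List ℕ → ℕ → ℕ
  | [] => env
  | v :: y => assign (Function.update env d v) (d + 1) y

theorem mem_tuples {B m : ℕ} {y : List ℕ} : y ∈ tuples B m ↔ y.length = m ∧ ∀ x ∈ y, x < B := by
  induction m generalizing y with
  | zero => cases y <;> simp [tuples]
  | succ m ih => cases y <;> simp [tuples, ih]; tauto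

theorem length_tuples (B m : ℕ) : (tuples B m).length = B ^ m := by
  induction m with
  | zero => simp [tuples]
  | succ m ih => simp [tuples, ih, List.length_flatMap, pow_succ, mul_comm]

theorem nodup_tuples (B m : ℕ) : (tuples B m).Nodup := by
  induction m with
  | zero => simp [tuples]
  | succ m ih =>
    rw [tuples, List.nodup_flatMap]
    refine ⟨fun v _ => ih.map fun _ _ h => (List.cons.inj h).2, ?_⟩
    refine List.nodup_range.imp fun {v v'} hv => ?_
    simp only [Function.onFun, List.disjoint_left, List.mem_map, not_exists, not_and]
    rintro _ ⟨y, _, rfl⟩ y' _ h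
    exact hv (List.cons.inj h).1.symm

theorem assign_of_lt (y : List ℕ) : ∀ {env : ℕ → ℕ} {d i : ℕ}, i < d → assign env d y i = env i := by
  induction y with
  | nil => exact fun _ => rfl
  | cons v y ih =>
    intro env d i hi
    rw [assign, ih (by omega), Function.update_of_ne hi.ne]

theorem map_assign (y : List ℕ) : ∀ {env : ℕ → ℕ} {d m : ℕ}, y.length = m →
    (List.range' d m).map (assign env d y) = y := by
  induction y with
  | nil => rintro env d m rfl; rfl
  | cons v y ih =>
    rintro env d m rfl
    rw [List.length_cons, List.range'_succ, List.map_cons, assign, ih rfl,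
      assign_of_lt y (Nat.lt_succ_self d), Function.update_self]

section Loops

variable {c d m : ℕ} {φ : World → (ℕ → ℕ) → Set (List ℕ) → Prop}
  {F : World → (ℕ → ℕ) → Set (List ℕ) × List ℕ → Set (List ℕ) × List ℕ}

theorem Dec.exTuple (h : Dec c (d + m) φ) :
    Dec c d fun w env T => ∃ y ∈ tuples (w.n + c + 2) m, φ w (assign env d y) T := by
  induction m generalizing d with
  | zero => exact h.congr fun w env T => by simp [tuples, assign]
  | succ m ih =>
    refine (ih (d := d + 1) (by rwa [add_right_comm])).ex.congr fun w env T => ?_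
    simp [tuples, assign]

theorem Cmd.forTuple (h : Cmd c (d + m) F) : Cmd c d fun w env σ =>
    (tuples (w.n + c + 2) m).foldl (fun σ y => F w (assign env d y) σ) σ := by
  induction m generalizing d with
  | zero => simpa [tuples, assign] using h
  | succ m ih =>
    have := (ih (d := d + 1) (by rwa [add_right_comm])).forAll
    simpa [tuples, assign, List.foldl_flatMap, List.foldl_map] using this

section Closure

variable (a m : ℕ) (ψ : List ℕ → Set (List ℕ) → Prop)

open Classical in
/-- For all `y` in the list, one after the other: insert `a :: y` into `T` if `ψ y T` is true. -/
noncomputable def sweep (L : List (List ℕ)) (T : Set (List ℕ)) : Set (List ℕ) :=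
  L.foldl (fun T y => if ψ y T then insert (a :: y) T else T) T

/-- Extend the table `T` by tuples that begin with `a` as long as the rule `ψ` requires it. -/
noncomputable def closeTable (B : ℕ) (T : Set (List ℕ)) : Set (List ℕ) :=
  (sweep a ψ (tuples B m))^[B ^ m] T

variable {a m ψ}

theorem subset_sweep (L : List (List ℕ)) (T : Set (List ℕ)) : T ⊆ sweep a ψ L T := by
  classical
  induction L generalizing T with
  | nil => exact subset_rfl
  | cons y L ih =>
    rw [sweep, List.foldl_cons]
    refine subset_trans ?_ (ih _)
    split_ifs
    · exact Set.subset_insert _ _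
    · exact subset_rfl

theorem sweep_closed {L : List (List ℕ)} {T : Set (List ℕ)} (h : sweep a ψ L T = T) {y : List ℕ}
    (hy : y ∈ L) (hψ : ψ y T) : a :: y ∈ T := by
  classical
  induction L with
  | nil => simp at hy
  | cons z L ih =>
    rw [sweep, List.foldl_cons] at h
    have h1 := subset_sweep (a := a) (ψ := ψ) L (if ψ z T then insert (a :: z) T else T)
    rw [sweep, h] at h1
    have h2 : (if ψ z T then insert (a :: z) T else T) = T := by
      refine subset_antisymm h1 ?_
      split_ifs
      · exact Set.subset_insert _ _
      · exact subset_rfl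
    rcases List.mem_cons.1 hy with rfl | hy
    · rw [if_pos hψ] at h1
      exact h1 (Set.mem_insert _ _)
    · rw [h2] at h
      exact ih h hy

theorem sweep_sound {T₀ : Set (List ℕ)} {U : List (List ℕ)} {Q : List ℕ → Prop}
    (hQ : ∀ S : Set (List ℕ), (∀ y ∈ S, Q y) → ∀ y ∈ U, ψ y (T₀ ∪ (a :: ·) '' S) → Q y)
    (L : List (List ℕ)) (hL : L ⊆ U) (T : Set (List ℕ))
    (hT : ∃ S : Set (List ℕ), T = T₀ ∪ (a :: ·) '' S ∧ ∀ y ∈ S, y ∈ U ∧ Q y) :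
    ∃ S : Set (List ℕ), sweep a ψ L T = T₀ ∪ (a :: ·) '' S ∧ ∀ y ∈ S, y ∈ U ∧ Q y := by
  classical
  induction L generalizing T with
  | nil => exact hT
  | cons y L ih =>
    rw [sweep, List.foldl_cons]
    refine ih (fun x hx => hL (List.mem_cons_of_mem _ hx)) _ ?_
    obtain ⟨S, rfl, hS⟩ := hT
    split_ifs with h
    · refine ⟨insert y S, by rw [Set.image_insert_eq, Set.union_insert], ?_⟩
      rintro z (rfl | hz)
      · exact ⟨hL List.mem_cons_self, hQ S (fun z hz => (hS z hz).2) _ (hL List.mem_cons_self) h⟩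
      · exact hS z hz
    · exact ⟨S, rfl, hS⟩

theorem iterate_fixed_of_measure {α : Type*} (f : α → α) (μ : α → ℕ)
    (hf : ∀ x, f x = x ∨ μ (f x) < μ x) (N : ℕ) (x : α) (hx : μ x ≤ N) :
    f (f^[N] x) = f^[N] x := by
  induction N generalizing x with
  | zero =>
    rcases hf x with h | h
    · exact h
    · omega
  | succ N ih =>
    rcases hf x with h | h
    · rw [Function.iterate_fixed h, h]
    · exact ih _ (by omega)

theorem closeTable_closed {B : ℕ} {T : Set (List ℕ)} {y : List ℕ} (hy : y ∈ tuples B m)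
    (hψ : ψ y (closeTable a m ψ B T)) : a :: y ∈ closeTable a m ψ B T := by
  classical
  refine sweep_closed (iterate_fixed_of_measure (sweep a ψ (tuples B m))
    (fun T => ((tuples B m).filter fun y => a :: y ∉ T).length) (fun T => ?_) _ _ ?_) hy hψ
  · by_cases h : ∀ y ∈ tuples B m, a :: y ∈ sweep a ψ (tuples B m) T → a :: y ∈ T
    · left
      obtain ⟨S, hS, hS'⟩ := sweep_sound (a := a) (ψ := ψ) (T₀ := T) (U := tuples B m)
        (Q := fun _ => True) (fun _ _ _ _ _ => trivial) (tuples B m) (fun _ h => h) T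
        ⟨∅, by simp, by simp⟩
      refine subset_antisymm ?_ (subset_sweep _ _)
      intro z hz
      rw [hS] at hz
      rcases hz with hz | ⟨y, hy, rfl⟩
      · exact hz
      · exact h y (hS' y hy).1 (hS ▸ .inr ⟨y, hy, rfl⟩)
    · right
      push Not at h
      obtain ⟨y, hy, h1, h2⟩ := h
      have hsub : List.Sublist ((tuples B m).filter fun y => a :: y ∉ sweep a ψ (tuples B m) T)
          ((tuples B m).filter fun y => a :: y ∉ T) := by
        refine List.monotone_filter_right _ fun z hz => ?_
        simp only [decide_eq_true_eq] at hz ⊢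
        exact fun h => hz (subset_sweep _ _ h)
      refine lt_of_le_of_ne hsub.length_le fun h => ?_
      have := hsub.eq_of_length h
      have hm : y ∈ (tuples B m).filter fun y => a :: y ∉ T := by simp [hy, h2]
      rw [← this] at hm
      simp [h1] at hm
  · exact (List.length_filter_le _ _).trans (length_tuples B m).le

theorem closeTable_sound (B : ℕ) (T : Set (List ℕ)) (Q : List ℕ → Prop)
    (hQ : ∀ S : Set (List ℕ), (∀ y ∈ S, Q y) →
      ∀ y ∈ tuples B m, ψ y (T ∪ (a :: ·) '' S) → Q y) :
    ∃ S : Set (List ℕ), closeTable a m ψ B T = T ∪ (a :: ·) '' S ∧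
      ∀ y ∈ S, y ∈ tuples B m ∧ Q y := by
  have : ∀ N, ∃ S : Set (List ℕ), (sweep a ψ (tuples B m))^[N] T = T ∪ (a :: ·) '' S ∧
      ∀ y ∈ S, y ∈ tuples B m ∧ Q y := by
    intro N
    induction N with
    | zero => exact ⟨∅, by simp, by simp⟩
    | succ N ih =>
      rw [Function.iterate_succ_apply']
      exact sweep_sound hQ _ (fun _ h => h) _ ih
  exact this _

theorem mem_closeTable_of_ne {B : ℕ} {T : Set (List ℕ)} {l : List ℕ} (h : ∀ y, l ≠ a :: y) :
    l ∈ closeTable a m ψ B T ↔ l ∈ T := by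
  obtain ⟨S, hS, -⟩ := closeTable_sound (a := a) (m := m) (ψ := ψ) B T (fun _ => True)
    fun _ _ _ _ _ => trivial
  rw [hS]
  constructor
  · rintro (h1 | ⟨y, -, rfl⟩)
    · exact h1
    · exact absurd rfl (h y)
  · exact .inl

end Closure

theorem Cmd.closeTable {a : ℕ} (ha : a < c + 2) (m : ℕ) (hd : 0 < d)
    {ψ : World → List ℕ → Set (List ℕ) → Prop}
    (hψ : ∀ d, 0 < d → Dec c (d + m) fun w env T => ψ w ((List.range' d m).map env) T) :
    Cmd c d fun w _ σ => (_root_.closeTable a m (ψ w) (w.n + c + 2) σ.1, σ.2) := by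
  classical
  have h1 : Cmd c (d + m) fun w _ σ => (sweep a (ψ w) (tuples (w.n + c + 2) m) σ.1, σ.2) := by
    have h := (Cmd.ite (hψ (d + m) (by omega)) (Cmd.insertTuple a (List.range' (d + m) m) ha
      (by intro x hx; simp at hx; omega)) Cmd.skip).forTuple
    convert h using 4 with w env σ
    have : ∀ L : List (List ℕ), L ⊆ tuples (w.n + c + 2) m → ∀ σ : Set (List ℕ) × List ℕ,
        (sweep a (ψ w) L σ.1, σ.2) = L.foldl (fun σ y =>
          if ψ w ((List.range' (d + m) m).map (assign env (d + m) y)) σ.1 then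
            (insert (a :: (List.range' (d + m) m).map (assign env (d + m) y)) σ.1, σ.2)
          else σ) σ := by
      intro L
      induction L with
      | nil => exact fun _ _ => rfl
      | cons y L ih =>
        intro hL σ
        rw [List.foldl_cons, ← ih fun x hx => hL (List.mem_cons_of_mem _ hx),
          map_assign y (mem_tuples.1 (hL List.mem_cons_self)).1, sweep, List.foldl_cons]
        split_ifs <;> simp [sweep]
    simpa using this _ (fun _ h => h) σ
  convert h1.forTuple using 4 with w env σ
  have : ∀ (L : List (List ℕ)) (σ : Set (List ℕ) × List ℕ),
      L.foldl (fun σ _ => (sweep a (ψ w) (tuples (w.n + c + 2) m) σ.1, σ.2)) σ =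
        ((sweep a (ψ w) (tuples (w.n + c + 2) m))^[L.length] σ.1, σ.2) := by
    intro L
    induction L with
    | nil => exact fun _ => rfl
    | cons y L ih => exact fun σ => by rw [List.foldl_cons, ih]; rfl
  rw [this, length_tuples]
  rfl

end Loops

/-! ### Transitive orientation by lexicographically first edges -/

/-- In every transitive orientation of `H`, the edge `cd` is oriented from `c` to `d` if and only
if `ab` is oriented from `a` to `b`, because of a sequence of edges in which any two consecutive
ones share a vertex and do not span a triangle. -/
inductive SameDir {V : Type*} (H : SimpleGraph V) (a b : V) : V → V → Prop
  | refl : H.Adj a b → SameDir H a b a b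
  | left {c d c' : V} : SameDir H a b c d → H.Adj c' d → ¬ H.Adj c c' → SameDir H a b c' d
  | right {c d d' : V} : SameDir H a b c d → H.Adj c d' → ¬ H.Adj d d' → SameDir H a b c d'

section Orientation

variable {V : Type*} {H : SimpleGraph V} {a b c d e f : V}

theorem SameDir.adj_left (h : SameDir H a b c d) : H.Adj a b := by
  induction h <;> assumption

theorem SameDir.adj_right (h : SameDir H a b c d) : H.Adj c d := by
  induction h <;> assumption

theorem SameDir.trans (h : SameDir H a b c d) (h' : SameDir H c d e f) : SameDir H a b e f := by
  induction h' with
  | refl => exact h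
  | left _ h1 h2 ih => exact ih.left h1 h2
  | right _ h1 h2 ih => exact ih.right h1 h2

theorem SameDir.symm (h : SameDir H a b c d) : SameDir H c d a b := by
  induction h with
  | refl h => exact .refl h
  | left h h1 h2 ih =>
    exact ((SameDir.refl h1).left h.adj_right fun h3 => h2 h3.symm).trans ih
  | right h h1 h2 ih =>
    exact ((SameDir.refl h1).right h.adj_right fun h3 => h2 h3.symm).trans ih

theorem SameDir.swap (h : SameDir H a b c d) : SameDir H b a d c := by
  induction h with
  | refl h => exact .refl h.symm
  | left _ h1 h2 ih => exact ih.right h1.symm h2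
  | right _ h1 h2 ih => exact ih.left h1.symm h2

theorem SameDir.rel {r : V → V → Prop} (hr : IsTransitiveOrientation H r)
    (h : SameDir H a b c d) (hab : r a b) : r c d := by
  induction h with
  | refl => exact hab
  | left h h1 h2 ih =>
    rcases (hr.oriented _ _ h1).or with h3 | h3
    · exact h3
    · exact absurd (hr.adj_of_rel _ _ (hr.trans _ _ _ ih h3)) h2
  | right h h1 h2 ih =>
    rcases (hr.oriented _ _ h1).or with h3 | h3
    · exact h3
    · exact absurd (hr.adj_of_rel _ _ (hr.trans _ _ _ h3 ih)).symm h2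

theorem SameDir.not_swap {r : V → V → Prop} (hr : IsTransitiveOrientation H r) :
    ¬ SameDir H a b b a := by
  intro h
  have h1 := hr.oriented a b h.adj_left
  rcases h1.or with h2 | h2
  · exact (xor_iff_or_and_not_and _ _).1 h1 |>.2 ⟨h2, h.rel hr h2⟩
  · exact (xor_iff_or_and_not_and _ _).1 h1 |>.2 ⟨h.symm.rel hr h2, h2⟩

/-- `ij` is the lexicographically first pair of adjacent vertices whose orientation determines the
orientation of `ab`. -/
def IsLeader [LinearOrder V] (H : SimpleGraph V) (a b i j : V) : Prop :=
  ∀ i' j', SameDir H a b i' j' ∨ SameDir H a b j' i' → i < i' ∨ i = i' ∧ j ≤ j'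

/-- The orientation of `H` in which the leading edges are oriented from the smaller to the larger
vertex. -/
def leadOrient [LinearOrder V] (H : SimpleGraph V) (a b : V) : Prop :=
  ∃ i j, SameDir H a b i j ∧ IsLeader H a b i j

variable [LinearOrder V]

theorem leadOrient.of_sameDir (h : leadOrient H a b) (h' : SameDir H a b c d) :
    leadOrient H c d := by
  obtain ⟨i, j, hs, hl⟩ := h
  exact ⟨i, j, h'.symm.trans hs, fun i' j' hij => hl i' j' (hij.imp h'.trans h'.trans)⟩

theorem leadOrient.asymm {r : V → V → Prop} (hr : IsTransitiveOrientation H r)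
    (h : leadOrient H a b) (h' : leadOrient H b a) : False := by
  obtain ⟨i, j, hs, hl⟩ := h
  obtain ⟨i', j', hs', hl'⟩ := h'
  have h1 := hl i' j' (.inr hs'.swap)
  have h2 := hl' i j (.inr hs.swap)
  have : i = i' ∧ j = j' := by
    rcases h1 with h1 | ⟨h1, h1'⟩ <;> rcases h2 with h2 | ⟨h2, h2'⟩
    · exact absurd h1 h2.not_gt
    · exact absurd h1 h2.not_gt
    · exact absurd h2 h1.not_gt
    · exact ⟨h1, le_antisymm h1' h2'⟩
  obtain ⟨rfl, rfl⟩ := this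
  exact SameDir.not_swap hr (hs.trans hs'.symm)

theorem leadOrient_or [WellFoundedLT V] (h : H.Adj a b) : leadOrient H a b ∨ leadOrient H b a := by
  have hne : {p : V ×ₗ V | SameDir H a b (ofLex p).1 (ofLex p).2 ∨
      SameDir H a b (ofLex p).2 (ofLex p).1}.Nonempty := ⟨toLex (a, b), .inl (.refl h)⟩
  obtain ⟨p, hp, hmin⟩ := WellFounded.has_min (wellFounded_lt (α := V ×ₗ V)) _ hne
  have hl : IsLeader H a b (ofLex p).1 (ofLex p).2 := by
    intro i' j' hij
    have := not_lt.1 (hmin (toLex (i', j')) hij)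
    rw [Prod.Lex.le_iff] at this
    exact this
  rcases hp with hp | hp
  · exact .inl ⟨_, _, hp, hl⟩
  · exact .inr ⟨_, _, hp.swap, fun i' j' hij =>
      hl i' j' (hij.symm.imp SameDir.swap SameDir.swap)⟩

/-- A cyclically oriented triangle stays one if an edge of it is replaced by an edge with the same
direction. -/
theorem cyclic_replace {r : V → V → Prop} (hr : IsTransitiveOrientation H r)
    (hab : leadOrient H a b) (hbc : leadOrient H b c) (hca : leadOrient H c a)
    (h : SameDir H b c d e) : SameDir H a b a d ∧ SameDir H c a e a := by
  have adj : ∀ {x y}, leadOrient H x y → H.Adj x y := fun ⟨_, _, h, _⟩ => h.adj_left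
  induction h with
  | refl => exact ⟨.refl (adj hab), .refl (adj hca)⟩
  | @left x y x' h h1 h2 ih =>
    refine ⟨ih.1.right ?_ h2, ih.2⟩
    by_contra h3
    refine leadOrient.asymm hr (hca.of_sameDir ih.2) (hbc.of_sameDir ((h.left h1 h2).left ?_ ?_))
    · exact ih.2.adj_right.symm
    · exact fun h4 => h3 h4.symm
  | @right x y y' h h1 h2 ih =>
    refine ⟨ih.1, ih.2.left ?_ h2⟩
    by_contra h3
    refine leadOrient.asymm hr (hab.of_sameDir ih.1) (hbc.of_sameDir ((h.right h1 h2).right ?_ h3))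
    exact ih.1.adj_right.symm

theorem not_cyclic [WellFoundedLT V] {r : V → V → Prop} (hr : IsTransitiveOrientation H r)
    (hab : leadOrient H a b) (hbc : leadOrient H b c) (hca : leadOrient H c a) : False := by
  have key : ∀ i : V, ∀ a b c j, leadOrient H a b → leadOrient H b c → leadOrient H c a →
      SameDir H b c i j → IsLeader H b c i j → False := by
    intro i
    induction i using WellFoundedLT.induction with
    | _ i ih =>
      intro a b c j hab hbc hca hs hl
      obtain ⟨h1, h2⟩ := cyclic_replace hr hab hbc hca hs
      have hai := hab.of_sameDir h1
      have hja := hca.of_sameDir h2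
      have hij := hbc.of_sameDir hs
      obtain ⟨p, q, hpq, hlead⟩ := id hai
      rcases hlead i a (.inr (.refl h1.adj_right)) with hp | ⟨rfl, -⟩
      · exact ih p hp j a i q hja hai hij hpq hlead
      · exact leadOrient.asymm hr hij (hja.of_sameDir (cyclic_replace hr hja hai hij hpq).1)
  obtain ⟨i, j, hs, hl⟩ := id hbc
  exact key i a b c j hab hbc hca hs hl

theorem isTransitiveOrientation_leadOrient [WellFoundedLT V] (h : IsComparabilityGraph H) :
    IsTransitiveOrientation H (leadOrient H) := by
  obtain ⟨r, hr⟩ := h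
  refine ⟨fun a b ⟨_, _, h, _⟩ => h.adj_left, fun a b h => ?_, fun a b c hab hbc => ?_⟩
  · rw [xor_iff_or_and_not_and]
    exact ⟨leadOrient_or h, fun h' => h'.1.asymm hr h'.2⟩
  · have h1 : H.Adj a b := hab.choose_spec.choose_spec.1.adj_left
    have h2 : H.Adj b c := hbc.choose_spec.choose_spec.1.adj_left
    by_cases h3 : H.Adj a c
    · exact (leadOrient_or h3).resolve_right fun hca => not_cyclic hr hab hbc hca
    · exact (hab.asymm hr (hbc.of_sameDir
        ((SameDir.refl h2).right h1.symm fun h4 => h3 h4.symm))).elim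

end Orientation

/-! ### Partitions of a partial order into chains -/

/-- The numbers `s i` and `t i`, for `i < k`, as a list. -/
def stateCode (k : ℕ) (s t : ℕ → ℕ) : List ℕ := (List.range k).map s ++ (List.range k).map t

/-- Every number below `n` is below one of `t 0`, …, `t (k - 1)`. -/
def CoversAll (n k : ℕ) (r : ℕ → ℕ → Prop) (t : ℕ → ℕ) : Prop :=
  ∀ u < n, ∃ i < k, u = t i ∨ r u (t i)

/-- The state given by the sizes `s` and the largest elements `t` of `k` chains, where `n` means
that the chain is empty, is the initial one or arises from a state in `S` when an element is put
on top of one of the chains. -/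
def ChainRule (n B k : ℕ) (r : ℕ → ℕ → Prop) (s t : ℕ → ℕ) (S : Set (List ℕ)) : Prop :=
  (∀ i < k, s i = 0 ∧ t i = n) ∨
    ∃ j < k, ∃ x < B, ∃ z < B,
      stateCode k (Function.update s j z) (Function.update t j x) ∈ S ∧ z + 1 = s j ∧ t j < n ∧
        (x = n ∨ r x (t j)) ∧
        (∀ u < B, r u (t j) → ∃ i < k, u = Function.update t j x i ∨ r u (Function.update t j x i)) ∧
        ∀ i < k, ¬ (t j = Function.update t j x i ∨ r (t j) (Function.update t j x i))

/-- The colors `col` partition the down-set `D` into `k` chains with sizes `s` and largest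
elements `t`. -/
structure IsChainState (n k : ℕ) (r : ℕ → ℕ → Prop) (col : ℕ → ℕ) (D : Finset ℕ) (s t : ℕ → ℕ) :
    Prop where
  lt : ∀ v ∈ D, v < n
  col_lt : ∀ v ∈ D, col v < k
  down : ∀ v ∈ D, ∀ u, r u v → u ∈ D
  card : ∀ i < k, s i = (D.filter fun v => col v = i).card
  top : ∀ i < k, (t i = n ∧ ∀ v ∈ D, col v ≠ i) ∨
    (t i ∈ D ∧ col (t i) = i ∧ ∀ v ∈ D, col v = i → v = t i ∨ r v (t i))
  chain : ∀ u ∈ D, ∀ v ∈ D, col u = col v → u ≠ v → r u v ∨ r v u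

theorem length_stateCode (k : ℕ) (s t : ℕ → ℕ) : (stateCode k s t).length = k + k := by
  simp [stateCode]

theorem getD_stateCode_left {k i : ℕ} (s t : ℕ → ℕ) (hi : i < k) :
    (stateCode k s t).getD i 0 = s i := by
  simp [stateCode, List.getElem?_append, hi]

theorem getD_stateCode_right {k i : ℕ} (s t : ℕ → ℕ) (hi : i < k) :
    (stateCode k s t).getD (k + i) 0 = t i := by
  simp [stateCode, hi]

theorem stateCode_congr {k : ℕ} {s s' t t' : ℕ → ℕ} (hs : ∀ i < k, s i = s' i)
    (ht : ∀ i < k, t i = t' i) : stateCode k s t = stateCode k s' t' := by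
  rw [stateCode, stateCode]
  congr 1
  · exact List.map_congr_left fun i hi => hs i (List.mem_range.1 hi)
  · exact List.map_congr_left fun i hi => ht i (List.mem_range.1 hi)

theorem ChainRule.congr {n B k : ℕ} {r : ℕ → ℕ → Prop} {s s' t t' : ℕ → ℕ} {S : Set (List ℕ)}
    (hs : ∀ i < k, s i = s' i) (ht : ∀ i < k, t i = t' i) (h : ChainRule n B k r s t S) :
    ChainRule n B k r s' t' S := by
  have hu : ∀ {f g : ℕ → ℕ} (j x : ℕ), (∀ i < k, f i = g i) →
      ∀ i < k, Function.update f j x i = Function.update g j x i := by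
    intro f g j x h i hi
    simp [Function.update_apply, h i hi]
  rcases h with h | ⟨j, hj, x, hx, z, hz, h1, h2, h3, h4, h5, h6⟩
  · exact .inl fun i hi => by rw [← hs i hi, ← ht i hi]; exact h i hi
  · refine .inr ⟨j, hj, x, hx, z, hz, ?_, by rw [← hs j hj]; exact h2, by rw [← ht j hj]; exact h3,
      by rw [← ht j hj]; exact h4, ?_, ?_⟩
    · rwa [← stateCode_congr (hu j z hs) (hu j x ht)]
    · intro u hub hur
      obtain ⟨i, hi, h⟩ := h5 u hub (by rwa [ht j hj])
      exact ⟨i, hi, by rwa [← hu j x ht i hi]⟩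
    · intro i hi
      rw [← hu j x ht i hi, ← ht j hj]
      exact h6 i hi

namespace IsChainState

variable {n k : ℕ} {r : ℕ → ℕ → Prop} {col : ℕ → ℕ} {D : Finset ℕ} {s t : ℕ → ℕ}

theorem mem_iff (hr : ∀ u v, r u v → u < n ∧ v < n) (h : IsChainState n k r col D s t) {u : ℕ}
    (hu : u < n) : u ∈ D ↔ ∃ i < k, u = t i ∨ r u (t i) := by
  constructor
  · intro hD
    refine ⟨col u, h.col_lt u hD, ?_⟩
    rcases h.top _ (h.col_lt u hD) with h1 | h1
    · exact absurd rfl (h1.2 u hD)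
    · exact h1.2.2 u hD rfl
  · rintro ⟨i, hi, h1⟩
    rcases h.top i hi with h2 | h2
    · rcases h1 with h1 | h1
      · omega
      · have := hr _ _ h1
        omega
    · rcases h1 with h1 | h1
      · exact h1 ▸ h2.1
      · exact h.down _ h2.1 _ h1

theorem congr_col {col' : ℕ → ℕ} (h : IsChainState n k r col D s t)
    (hc : ∀ v ∈ D, col v = col' v) : IsChainState n k r col' D s t where
  lt := h.lt
  col_lt v hv := by rw [← hc v hv]; exact h.col_lt v hv
  down := h.down
  card i hi := by
    rw [h.card i hi]
    congr 1
    exact Finset.filter_congr fun v hv => by rw [hc v hv]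
  top i hi := by
    rcases h.top i hi with h1 | h1
    · exact .inl ⟨h1.1, fun v hv => by rw [← hc v hv]; exact h1.2 v hv⟩
    · exact .inr ⟨h1.1, by rw [← hc _ h1.1]; exact h1.2.1,
        fun v hv hvi => h1.2.2 v hv (by rw [hc v hv]; exact hvi)⟩
  chain u hu v hv huv := h.chain u hu v hv (by rwa [hc u hu, hc v hv])

theorem congr_state {s' t' : ℕ → ℕ} (h : IsChainState n k r col D s t)
    (hs : ∀ i < k, s i = s' i) (ht : ∀ i < k, t i = t' i) : IsChainState n k r col D s' t' where
  lt := h.lt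
  col_lt := h.col_lt
  down := h.down
  card i hi := by rw [← hs i hi]; exact h.card i hi
  top i hi := by rw [← ht i hi]; exact h.top i hi
  chain := h.chain

theorem top_rel (h : IsChainState n k r col D s t) (htr : ∀ u v w, r u v → r v w → r u w)
    {v : ℕ} {j : ℕ} (hj : j < k) (hx : t j = n ∨ r (t j) v) {u : ℕ} (hu : u ∈ D)
    (huj : col u = j) : r u v := by
  rcases h.top j hj with h1 | h1
  · exact absurd huj (h1.2 u hu)
  · have hv : r (t j) v := hx.resolve_left (h.lt _ h1.1).ne
    rcases h1.2.2 u hu huj with rfl | h2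
    · exact hv
    · exact htr _ _ _ h2 hv

theorem insert (h : IsChainState n k r col D s t) (htr : ∀ u v w, r u v → r v w → r u w)
    {v : ℕ} (hv : v < n) (hvD : v ∉ D) {j : ℕ} (hj : j < k) (hcol : col v = j)
    (hx : t j = n ∨ r (t j) v) (hdown : ∀ u, r u v → u ∈ D) :
    IsChainState n k r col (insert v D) (Function.update s j (s j + 1)) (Function.update t j v) where
  lt u hu := by
    rcases Finset.mem_insert.1 hu with rfl | hu
    · exact hv
    · exact h.lt u hu
  col_lt u hu := by
    rcases Finset.mem_insert.1 hu with rfl | hu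
    · exact hcol ▸ hj
    · exact h.col_lt u hu
  down u hu w hw := by
    rcases Finset.mem_insert.1 hu with rfl | hu
    · exact Finset.mem_insert_of_mem (hdown w hw)
    · exact Finset.mem_insert_of_mem (h.down u hu w hw)
  card i hi := by
    rw [Finset.filter_insert]
    by_cases hij : i = j
    · subst hij
      rw [if_pos hcol, Finset.card_insert_of_notMem (by simp [hvD]), Function.update_self,
        h.card i hi]
    · rw [if_neg (by rw [hcol]; exact fun h => hij h.symm), Function.update_of_ne hij, h.card i hi]
  top i hi := by
    by_cases hij : i = j
    · subst hij
      right
      rw [Function.update_self]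
      refine ⟨Finset.mem_insert_self _ _, hcol, fun u hu hui => ?_⟩
      rcases Finset.mem_insert.1 hu with rfl | hu
      · exact .inl rfl
      · exact .inr (h.top_rel htr hi hx hu hui)
    · rw [Function.update_of_ne hij]
      rcases h.top i hi with h1 | h1
      · refine .inl ⟨h1.1, fun u hu => ?_⟩
        rcases Finset.mem_insert.1 hu with rfl | hu
        · rw [hcol]; exact fun h => hij h.symm
        · exact h1.2 u hu
      · refine .inr ⟨Finset.mem_insert_of_mem h1.1, h1.2.1, fun u hu hui => ?_⟩
        rcases Finset.mem_insert.1 hu with rfl | hu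
        · exact absurd (hui.symm.trans hcol) hij
        · exact h1.2.2 u hu hui
  chain u hu w hw huw hne := by
    rcases Finset.mem_insert.1 hu with rfl | hu'
    · rcases Finset.mem_insert.1 hw with rfl | hw'
      · exact absurd rfl hne
      · exact .inr (h.top_rel htr hj hx hw' (huw.symm.trans hcol))
    · rcases Finset.mem_insert.1 hw with rfl | hw'
      · exact .inl (h.top_rel htr hj hx hu' (huw.trans hcol))
      · exact h.chain u hu' w hw' huw hne

end IsChainState

section ChainStates

variable {n B k : ℕ} {r : ℕ → ℕ → Prop} {S : Set (List ℕ)}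

theorem ChainRule.sound (hr : ∀ u v, r u v → u < n ∧ v < n) (hB : n < B)
    (htr : ∀ u v w, r u v → r v w → r u w)
    (hS : ∀ y ∈ S, ∃ col D, IsChainState n k r col D (fun i => y.getD i 0) fun i => y.getD (k + i) 0)
    {s t : ℕ → ℕ} (h : ChainRule n B k r s t S) : ∃ col D, IsChainState n k r col D s t := by
  rcases h with h | ⟨j, hj, x, hx, z, hz, h1, h2, h3, h4, h5, h6⟩
  · exact ⟨fun _ => 0, ∅, by simp, by simp, by simp, fun i hi => by simp [h i hi],
      fun i hi => .inl ⟨(h i hi).2, by simp⟩, by simp⟩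
  · obtain ⟨col, D, hD⟩ := hS _ h1
    replace hD := hD.congr_state (fun i hi => getD_stateCode_left _ _ hi)
      fun i hi => getD_stateCode_right _ _ hi
    have hv : t j ∉ D := by
      rw [hD.mem_iff hr h3]
      rintro ⟨i, hi, h⟩
      exact h6 i hi h
    have hD' := hD.congr_col (col' := Function.update col (t j) j) fun v hvD => by
      rw [Function.update_of_ne]
      rintro rfl
      exact hv hvD
    refine ⟨_, _, (hD'.insert htr h3 hv hj (Function.update_self ..) (by simpa using h4)
      fun u hu => ?_).congr_state ?_ ?_⟩
    · exact (hD.mem_iff hr (hr _ _ hu).1).2 (h5 u ((hr _ _ hu).1.trans hB) hu)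
    · intro i _
      by_cases hij : i = j
      · subst hij; simp [h2]
      · simp [hij]
    · intro i _
      by_cases hij : i = j
      · subst hij; simp
      · simp [hij]

theorem IsChainState.eq_range {col : ℕ → ℕ} {D : Finset ℕ} {s t : ℕ → ℕ}
    (hr : ∀ u v, r u v → u < n ∧ v < n) (h : IsChainState n k r col D s t)
    (hc : CoversAll n k r t) : D = Finset.range n := by
  ext u
  rw [Finset.mem_range]
  exact ⟨h.lt u, fun hu => (h.mem_iff hr hu).2 (hc u hu)⟩

theorem exists_chainState_of_closed (hr : ∀ u v, r u v → u < n ∧ v < n) (hB : n < B)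
    (htr : ∀ u v w, r u v → r v w → r u w) (hirr : ∀ u, ¬ r u u)
    (hS : ∀ s t : ℕ → ℕ, (∀ i < k, s i < B) → (∀ i < k, t i < B) →
      ChainRule n B k r s t S → stateCode k s t ∈ S)
    {col : ℕ → ℕ} (hcol : ∀ v < n, col v < k)
    (hchain : ∀ u < n, ∀ v < n, col u = col v → u ≠ v → r u v ∨ r v u) (m : ℕ) (hm : m ≤ n) :
    ∃ D s t, D.card = m ∧ IsChainState n k r col D s t ∧ stateCode k s t ∈ S := by
  have hbound : ∀ {D s t}, IsChainState n k r col D s t → (∀ i < k, s i < B) ∧ ∀ i < k, t i < B := by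
    intro D s t h
    constructor
    · intro i hi
      rw [h.card i hi]
      refine lt_of_le_of_lt ?_ hB
      have : D.filter (fun v => col v = i) ⊆ Finset.range n := fun v hv =>
        Finset.mem_range.2 (h.lt v (Finset.mem_filter.1 hv).1)
      simpa using Finset.card_le_card this
    · intro i hi
      rcases h.top i hi with h1 | h1
      · rw [h1.1]; exact hB
      · exact (h.lt _ h1.1).trans hB
  induction m with
  | zero =>
    have h : IsChainState n k r col ∅ (fun _ => 0) fun _ => n :=
      ⟨by simp, by simp, by simp, by simp, by simp, by simp⟩
    exact ⟨∅, _, _, rfl, h, hS _ _ (hbound h).1 (hbound h).2 (.inl fun i _ => ⟨rfl, rfl⟩)⟩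
  | succ m ih =>
    obtain ⟨D, s, t, hD, h, hmem⟩ := ih (by omega)
    have hne : ((Finset.range n) \ D).Nonempty := by
      rw [← Finset.card_pos]
      have := Finset.le_card_sdiff D (Finset.range n)
      rw [Finset.card_range] at this
      omega
    have : IsStrictOrder ℕ r := { irrefl := hirr, trans := htr }
    have hwf := Finset.wellFoundedOn ((Finset.range n) \ D) (r := r)
    obtain ⟨v, hv, hmin⟩ : ∃ v ∈ Finset.range n \ D, ∀ u ∈ Finset.range n \ D, ¬ r u v := by
      obtain ⟨v, -, hmin⟩ := hwf.has_min Set.univ ⟨⟨_, hne.choose_spec⟩, trivial⟩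
      exact ⟨v, v.2, fun u hu => hmin ⟨u, hu⟩ trivial⟩
    rw [Finset.mem_sdiff, Finset.mem_range] at hv
    have hdown : ∀ u, r u v → u ∈ D := by
      intro u hu
      by_contra h1
      exact hmin u (by simp [h1, (hr _ _ hu).1]) hu
    have hj := hcol v hv.1
    have hx : t (col v) = n ∨ r (t (col v)) v := by
      rcases h.top _ hj with h1 | h1
      · exact .inl h1.1
      · refine .inr ((hchain _ (h.lt _ h1.1) v hv.1 h1.2.1 ?_).resolve_right fun h2 => ?_)
        · intro h2
          exact hv.2 (h2 ▸ h1.1)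
        · exact hv.2 (h.down _ h1.1 _ h2)
    have h' := h.insert htr hv.1 hv.2 hj rfl hx hdown
    refine ⟨_, _, _, by rw [Finset.card_insert_of_notMem hv.2, hD], h', ?_⟩
    refine hS _ _ (hbound h').1 (hbound h').2 (.inr ⟨col v, hj, t (col v), (hbound h).2 _ hj,
      s (col v), (hbound h).1 _ hj, ?_, ?_, ?_, ?_, ?_, ?_⟩)
    · simpa using hmem
    · simp
    · simpa using hv.1
    · simpa using hx
    · intro u _ hu
      have hu : r u v := by simpa using hu
      simpa using (h.mem_iff hr (hr _ _ hu).1).1 (hdown u hu)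
    · have := mt (h.mem_iff hr hv.1).2 hv.2
      simpa using this

end ChainStates

/-! ### The rules of the algorithm as decidable predicates -/

/-- Adjacency in the complement of the input graph. -/
def World.CoAdj (w : World) (a b : ℕ) : Prop := a < w.n ∧ b < w.n ∧ a ≠ b ∧ ¬ w.adj a b

/-- The tuple `[a, b, u, v]` belongs to the relation `SameDir`, as far as it is known from the
table. -/
def SameDirRule (c : ℕ) (w : World) (y : List ℕ) (T : Set (List ℕ)) : Prop :=
  w.CoAdj (y.getD 2 0) (y.getD 3 0) ∧
    ((y.getD 0 0 = y.getD 2 0 ∧ y.getD 1 0 = y.getD 3 0) ∨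
      ∃ v < w.n + c + 2,
        ([1, y.getD 0 0, y.getD 1 0, v, y.getD 3 0] ∈ T ∧ ¬ w.CoAdj v (y.getD 2 0)) ∨
          ([1, y.getD 0 0, y.getD 1 0, y.getD 2 0, v] ∈ T ∧ ¬ w.CoAdj v (y.getD 3 0)))

/-- The relation `leadOrient`, read off from a table that contains the relation `SameDir`. -/
def LeadRel (B : ℕ) (T : Set (List ℕ)) (a b : ℕ) : Prop :=
  ∃ i < B, ∃ j < B, [1, a, b, i, j] ∈ T ∧
    ∀ i' < B, ∀ j' < B, ([1, a, b, i', j'] ∈ T ∨ [1, a, b, j', i'] ∈ T) →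
      i < i' ∨ i = i' ∧ j ≤ j'

/-- `ChainRule` for the states in the table that are marked with `k + 2`. -/
def TableChainRule (c k : ℕ) (w : World) (y : List ℕ) (T : Set (List ℕ)) : Prop :=
  ChainRule w.n (w.n + c + 2) k (LeadRel (w.n + c + 2) T) (fun i => y.getD i 0)
    (fun i => y.getD (k + i) 0) {z | (k + 2) :: z ∈ T}

/-- The list `y` is non-decreasing and, according to the table, consists of the sizes of the chains
of a partition into `k` chains. -/
def AcceptRule (c k : ℕ) (w : World) (y : List ℕ) (T : Set (List ℕ)) : Prop :=
  (∀ i < k, ∀ j < k, i < j → y.getD i 0 ≤ y.getD j 0) ∧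
    ∃ z ∈ tuples (w.n + c + 2) k,
      CoversAll w.n k (LeadRel (w.n + c + 2) T) (fun i => z.getD i 0) ∧ (k + 2) :: (y ++ z) ∈ T

section Rules

variable {c d : ℕ}

theorem Dec.coAdj {x y : ℕ} (hx : x < d) (hy : y < d) :
    Dec c d fun w env _ => w.CoAdj (env x) (env y) :=
  ((Dec.var_lt_size hx).and ((Dec.var_lt_size hy).and
    ((Dec.var_eq hx hy).not.and (Dec.adj hx hy).not))).congr fun w env T => by
      simp only [World.CoAdj]; tauto

theorem Dec.var_eq_zero {x : ℕ} (hx : x < d) : Dec c d fun _ env _ => env x = 0 := by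
  refine ⟨.branch (x + 7) (.const 0 0) (.const 0 1), 2, fun w env T out s h => ?_⟩
  have hv := h.var x hx
  by_cases h0 : env x = 0
  · exact ⟨_, _, .branch_zero (by rw [hv, h0]) (.const _ _ _), h.frame (.setReg _ _ (by omega)),
      by simp [h0], by simp⟩
  · exact ⟨_, _, .branch_pos (by rwa [hv]) (.const _ _ _), h.frame (.setReg _ _ (by omega)),
      by simp [h0], by simp⟩

theorem Dec.of_meta {p : Prop} {φ : World → (ℕ → ℕ) → Set (List ℕ) → Prop}
    (h : p → Dec c d φ) : Dec c d fun w env T => p → φ w env T := by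
  by_cases hp : p
  · exact (h hp).congr fun _ _ _ => by simp [hp]
  · exact Dec.const_true.congr fun _ _ _ => by simp [hp]

theorem map_range'_four (env : ℕ → ℕ) (d : ℕ) :
    (List.range' d 4).map env = [env d, env (d + 1), env (d + 2), env (d + 3)] := rfl

theorem Dec.sameDirRule (d : ℕ) :
    Dec c (d + 4) fun w env T => SameDirRule c w ((List.range' d 4).map env) T := by
  have h1 : Dec c (d + 4 + 1) fun w env T =>
      (1 :: [d, d + 1, d + 4, d + 3].map env ∈ T ∧ ¬ w.CoAdj (env (d + 4)) (env (d + 2))) ∨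
        (1 :: [d, d + 1, d + 2, d + 4].map env ∈ T ∧ ¬ w.CoAdj (env (d + 4)) (env (d + 3))) :=
    ((Dec.mem_table 1 _ (by omega) (by simp)).and (Dec.coAdj (by omega) (by omega)).not).or
      ((Dec.mem_table 1 _ (by omega) (by simp)).and (Dec.coAdj (by omega) (by omega)).not)
  refine ((Dec.coAdj (x := d + 2) (y := d + 3) (by omega) (by omega)).and
    (((Dec.var_eq (x := d) (y := d + 2) (by omega) (by omega)).and
      (Dec.var_eq (x := d + 1) (y := d + 3) (by omega) (by omega))).or h1.ex)).congr ?_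
  intro w env T
  simp [SameDirRule, map_range'_four]

theorem Dec.leadRel {x y : ℕ} (hx : x < d) (hy : y < d) :
    Dec c d fun w env T => LeadRel (w.n + c + 2) T (env x) (env y) := by
  have h1 : Dec c (d + 1 + 1 + 1 + 1) fun w env T =>
      (1 :: [x, y, d + 2, d + 3].map env ∈ T ∨ 1 :: [x, y, d + 3, d + 2].map env ∈ T) →
        env d < env (d + 2) ∨ env d = env (d + 2) ∧ env (d + 1) ≤ env (d + 3) :=
    ((Dec.mem_table 1 _ (by omega) (by simp; omega)).or
      (Dec.mem_table 1 _ (by omega) (by simp; omega))).imp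
      ((Dec.var_lt (by omega) (by omega)).or
        ((Dec.var_eq (by omega) (by omega)).and (Dec.var_le (by omega) (by omega))))
  have h2 : Dec c (d + 1 + 1) fun w env T => 1 :: [x, y, d, d + 1].map env ∈ T :=
    Dec.mem_table 1 _ (by omega) (by simp; omega)
  refine (h2.and h1.all.all).ex.ex.congr fun w env T => ?_
  have e1 : x ≠ d := hx.ne
  have e2 : y ≠ d := hy.ne
  have e3 : x ≠ d + 1 := by omega
  have e4 : y ≠ d + 1 := by omega
  have e5 : x ≠ d + 1 + 1 := by omega
  have e6 : y ≠ d + 1 + 1 := by omega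
  have e7 : x ≠ d + 1 + 1 + 1 := by omega
  have e8 : y ≠ d + 1 + 1 + 1 := by omega
  have e9 : x ≠ d + 2 := by omega
  have e10 : y ≠ d + 2 := by omega
  have e11 : x ≠ d + 3 := by omega
  have e12 : y ≠ d + 3 := by omega
  simp [LeadRel, *]

theorem Dec.coversAll {k e : ℕ} (h : e + k ≤ d) : Dec c d fun w env T =>
    CoversAll w.n k (LeadRel (w.n + c + 2) T) fun i => env (e + i) := by
  have h1 : Dec c (d + 1) fun w env T => env d < w.n →
      ∃ i < k, env d = env (e + i) ∨ LeadRel (w.n + c + 2) T (env d) (env (e + i)) :=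
    (Dec.var_lt_size (by omega)).imp (Dec.exFin fun i hi =>
      (Dec.var_eq (by omega) (by omega)).or (Dec.leadRel (by omega) (by omega)))
  refine h1.all.congr fun w env T => ?_
  have hu : ∀ v, ∀ i < k, Function.update env d v (e + i) = env (e + i) := fun v i hi =>
    Function.update_of_ne (by omega) _ _
  have key : ∀ v, (∃ i < k, v = env (e + i) ∨ LeadRel (w.n + c + 2) T v (env (e + i))) ↔
      ∃ i < k, v = Function.update env d v (e + i) ∨
        LeadRel (w.n + c + 2) T v (Function.update env d v (e + i)) := fun v =>
    exists_congr fun i => and_congr_right fun hi => by rw [hu v i hi]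
  simp only [CoversAll, Function.update_self, ← key]
  exact ⟨fun h v _ hv => h v hv, fun h v hv => h v (by omega) hv⟩

/-- One step of `ChainRule` for a fixed color, where `s`, `t` are the variables from number `e` on
and the changed values are those of the variables `p` and `p + 1`. -/
theorem Dec.chainStep {k j e p : ℕ} (hj : j < k) (hk : k < c) (hp : e + k + k ≤ p) :
    Dec c p fun w env T => ∃ x < w.n + c + 2, ∃ z < w.n + c + 2,
      stateCode k (Function.update (fun i => env (e + i)) j z)
        (Function.update (fun i => env (e + k + i)) j x) ∈ {z | (k + 2) :: z ∈ T} ∧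
      z + 1 = env (e + j) ∧ env (e + k + j) < w.n ∧
      (x = w.n ∨ LeadRel (w.n + c + 2) T x (env (e + k + j))) ∧
      (∀ u < w.n + c + 2, LeadRel (w.n + c + 2) T u (env (e + k + j)) → ∃ i < k,
        u = Function.update (fun i => env (e + k + i)) j x i ∨
          LeadRel (w.n + c + 2) T u (Function.update (fun i => env (e + k + i)) j x i)) ∧
      ∀ i < k, ¬ (env (e + k + j) = Function.update (fun i => env (e + k + i)) j x i ∨
        LeadRel (w.n + c + 2) T (env (e + k + j))
          (Function.update (fun i => env (e + k + i)) j x i)) := by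
  set sv : ℕ → ℕ := fun i => if i = j then p + 1 else e + i with hsv
  set tv : ℕ → ℕ := fun i => if i = j then p else e + k + i with htv
  have hs_lt : ∀ i < k, sv i < p + 2 := fun i hi => by simp only [hsv]; split_ifs <;> omega
  have ht_lt : ∀ i < k, tv i < p + 2 := fun i hi => by simp only [htv]; split_ifs <;> omega
  have h1 : Dec c (p + 1 + 1) fun w env T =>
      (k + 2) :: ((List.range k).map sv ++ (List.range k).map tv).map env ∈ T := by
    refine Dec.mem_table _ _ (by omega) fun x hx => ?_
    simp only [List.mem_append, List.mem_map, List.mem_range] at hx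
    rcases hx with ⟨i, hi, rfl⟩ | ⟨i, hi, rfl⟩
    · exact hs_lt i hi
    · exact ht_lt i hi
  have h2 : Dec c (p + 1 + 1) fun w env T => env (p + 1) + 1 = env (e + j) ∧
      env (e + k + j) < w.n ∧ (env p = w.n ∨ LeadRel (w.n + c + 2) T (env p) (env (e + k + j))) :=
    (Dec.var_succ_eq (by omega) (by omega)).and ((Dec.var_lt_size (by omega)).and
      ((Dec.var_eq_size (by omega)).or (Dec.leadRel (by omega) (by omega))))
  have h3 : Dec c (p + 1 + 1 + 1) fun w env T =>
      LeadRel (w.n + c + 2) T (env (p + 2)) (env (e + k + j)) → ∃ i < k,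
        env (p + 2) = env (tv i) ∨ LeadRel (w.n + c + 2) T (env (p + 2)) (env (tv i)) :=
    (Dec.leadRel (by omega) (by omega)).imp (Dec.exFin fun i hi =>
      (Dec.var_eq (by omega) (by have := ht_lt i hi; omega)).or
        (Dec.leadRel (by omega) (by have := ht_lt i hi; omega)))
  have h4 : Dec c (p + 1 + 1) fun w env T => ∀ i < k, ¬ (env (e + k + j) = env (tv i) ∨
      LeadRel (w.n + c + 2) T (env (e + k + j)) (env (tv i))) :=
    Dec.allFin fun i hi => ((Dec.var_eq (by omega) (ht_lt i hi)).or
      (Dec.leadRel (by omega) (ht_lt i hi))).not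
  refine (h1.and (h2.and (h3.all.and h4))).ex.ex.congr fun w env T => ?_
  refine exists_congr fun x => and_congr_right fun _ => exists_congr fun z =>
    and_congr_right fun _ => ?_
  set env' := Function.update (Function.update env p x) (p + 1) z with henv
  have e1 : env' (p + 1) = z := Function.update_self ..
  have e2 : env' p = x := by simp [henv]
  have e3 : ∀ i < p, env' i = env i := fun i hi => by
    rw [henv, Function.update_of_ne (by omega), Function.update_of_ne (by omega)]
  have e4 : ∀ i < k, Function.update (fun i => env (e + i)) j z i = env' (sv i) := by
    intro i hi
    by_cases hij : i = j
    · simp [hsv, hij, e1]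
    · simp [hsv, hij, e3 (e + i) (by omega)]
  have e5 : ∀ i < k, Function.update (fun i => env (e + k + i)) j x i = env' (tv i) := by
    intro i hi
    by_cases hij : i = j
    · simp [htv, hij, e2]
    · simp [htv, hij, e3 (e + k + i) (by omega)]
  have e6 : ∀ u, ∀ i < p + 2, Function.update env' (p + 1 + 1) u i = env' i := fun u i hi =>
    Function.update_of_ne (by omega) _ _
  have e7 : ∀ u, Function.update env' (p + 1 + 1) u (p + 2) = u := fun u => Function.update_self ..
  rw [stateCode_congr e4 e5, e1, e2, e3 (e + j) (by omega), e3 (e + k + j) (by omega)]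
  simp only [and_assoc]
  refine and_congr ?_ (and_congr_right fun _ => and_congr_right fun _ => and_congr_right fun _ =>
    and_congr ?_ ?_)
  · simp [stateCode, Function.comp_def]
  · refine forall_congr' fun u => forall_congr' fun _ => ?_
    rw [e7, e6 _ (e + k + j) (by omega), e3 (e + k + j) (by omega)]
    refine imp_congr Iff.rfl (exists_congr fun i => and_congr_right fun hi => ?_)
    rw [e6 _ _ (ht_lt i hi), e5 i hi]
  · refine forall_congr' fun i => forall_congr' fun hi => ?_
    rw [e5 i hi]

theorem Dec.tableChainRule {k : ℕ} (hk : k < c) (e : ℕ) : Dec c (e + (k + k)) fun w env T =>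
    TableChainRule c k w ((List.range' e (k + k)).map env) T := by
  have h1 : Dec c (e + (k + k)) fun w env T => ∀ i < k, env (e + i) = 0 ∧ env (e + k + i) = w.n :=
    Dec.allFin fun i hi => (Dec.var_eq_zero (by omega)).and (Dec.var_eq_size (by omega))
  refine (h1.or (Dec.exFin fun j hj => Dec.chainStep (e := e) hj hk (by omega))).congr ?_
  intro w env T
  have hs : ∀ i < k, ((List.range' e (k + k)).map env).getD i 0 = env (e + i) := fun i hi => by
    simp [show i < k + k by omega]
  have ht : ∀ i < k, ((List.range' e (k + k)).map env).getD (k + i) 0 = env (e + k + i) :=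
    fun i hi => by simp [show k + i < k + k by omega, add_assoc]
  exact ⟨fun h => ChainRule.congr hs ht h,
    fun h => ChainRule.congr (fun i hi => (hs i hi).symm) (fun i hi => (ht i hi).symm) h⟩

theorem Dec.acceptRule {k : ℕ} (hk : k < c) (e : ℕ) : Dec c (e + k) fun w env T =>
    AcceptRule c k w ((List.range' e k).map env) T := by
  have h1 : Dec c (e + k) fun w env T => ∀ i < k, ∀ j < k, i < j → env (e + i) ≤ env (e + j) :=
    Dec.allFin fun i hi => Dec.allFin fun j hj => Dec.of_meta fun _ =>
      Dec.var_le (by omega) (by omega)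
  have h2 : Dec c (e + k + k) fun w env T =>
      CoversAll w.n k (LeadRel (w.n + c + 2) T) (fun i => env (e + k + i)) ∧
        (k + 2) :: (List.range' e (k + k)).map env ∈ T :=
    (Dec.coversAll le_rfl).and (Dec.mem_table _ _ (by omega) (by
      intro x hx; simp at hx; omega))
  refine (h1.and h2.exTuple).congr fun w env T => ?_
  have hs : ∀ i < k, ((List.range' e k).map env).getD i 0 = env (e + i) := fun i hi => by
    simp [hi]
  refine and_congr ?_ (exists_congr fun z => and_congr_right fun hz => and_congr ?_ ?_)
  · exact forall_congr' fun i => forall_congr' fun hi => forall_congr' fun j =>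
      forall_congr' fun hj => by rw [hs i hi, hs j hj]
  · have hz' := map_assign z (env := env) (d := e + k) (mem_tuples.1 hz).1
    have : ∀ i < k, z.getD i 0 = assign env (e + k) z (e + k + i) := fun i hi => by
      conv_lhs => rw [← hz']
      simp [hi]
    refine forall_congr' fun u => forall_congr' fun _ => exists_congr fun i =>
      and_congr_right fun hi => ?_
    simp only [this i hi]
  · rw [← List.range'_append_1, List.map_append, map_assign z (mem_tuples.1 hz).1]
    have : (List.range' e k).map (assign env (e + k) z) = (List.range' e k).map env :=
      List.map_congr_left fun i hi => assign_of_lt _ (by simp at hi; omega)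
    rw [this]

theorem Cmd.print_vars (l : List ℕ) (hl : ∀ x ∈ l, x < d) :
    Cmd c d fun _ env σ => (σ.1, σ.2 ++ l.map env) := by
  induction l with
  | nil => simpa using Cmd.skip
  | cons x l ih =>
    have := (Cmd.print_var (c := c) (hl x (by simp))).seq (ih fun y hy => hl y (by simp [hy]))
    simpa using this

end Rules

/-! ### Types of colorings as sorted lists -/

section ColoringType

variable {V : Type*} {G : SimpleGraph V} {k : ℕ}

theorem coloringType_of_monotone (C : G.Coloring (Fin k)) {f : Fin k → ℕ}
    (hf : ∀ i, (C.colorClass i).ncard = f i) (hm : Monotone f) : coloringType C = List.ofFn f := by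
  have : (fun i => (C.colorClass i).ncard) = f := funext hf
  rw [coloringType, this, Fin.univ_val_map, Multiset.coe_sort]
  exact List.mergeSort_eq_self _ (List.pairwise_ofFn.2 fun i j hij => hm hij.le)

theorem exists_coloring_monotone (C : G.Coloring (Fin k)) :
    ∃ C' : G.Coloring (Fin k), (Monotone fun i => (C'.colorClass i).ncard) ∧
      coloringType C' = coloringType C := by
  set f : Fin k → ℕ := fun i => (C.colorClass i).ncard with hf
  set σ := Tuple.sort f with hσ
  let C' : G.Coloring (Fin k) := SimpleGraph.Coloring.mk (fun v => σ.symm (C v)) fun h h' =>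
    C.valid h (σ.symm.injective h')
  have hC' : (fun i => (C'.colorClass i).ncard) = f ∘ σ := by
    funext i
    have : C'.colorClass i = C.colorClass (σ i) := by
      ext v
      change σ.symm (C v) = i ↔ C v = σ i
      rw [Equiv.symm_apply_eq]
    rw [this]
    rfl
  refine ⟨C', by rw [hC']; exact Tuple.monotone_sort f, ?_⟩
  rw [coloringType, coloringType, hC', ← hf, ← Multiset.map_map]
  congr 2
  exact Multiset.map_univ_val_equiv σ

theorem length_coloringType (C : G.Coloring (Fin k)) : (coloringType C).length = k := by
  simp [coloringType]

theorem le_card_of_mem_coloringType [Finite V] (C : G.Coloring (Fin k)) {x : ℕ}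
    (hx : x ∈ coloringType C) : x ≤ Nat.card V := by
  rw [coloringType, Multiset.mem_sort, Multiset.mem_map] at hx
  obtain ⟨i, -, rfl⟩ := hx
  exact Set.ncard_le_card _

end ColoringType

theorem ncard_eq_card_filter_range {n : ℕ} (A : Set (Fin n))
    [DecidablePred fun v => ∃ h : v < n, (⟨v, h⟩ : Fin n) ∈ A] :
    A.ncard = ((Finset.range n).filter fun v => ∃ h : v < n, (⟨v, h⟩ : Fin n) ∈ A).card := by
  rw [← Set.ncard_image_of_injective A Fin.val_injective, ← Set.ncard_coe_finset]
  congr 1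
  ext v
  simp only [Set.mem_image, Finset.coe_filter, Finset.mem_range, Set.mem_ofPred_eq]
  constructor
  · rintro ⟨u, hu, rfl⟩
    exact ⟨u.2, u.2, hu⟩
  · rintro ⟨_, h, hv⟩
    exact ⟨_, hv, rfl⟩

/-! ### The input graph -/

/-- The graph `G` as the input of a program. -/
def SimpleGraph.world {n : ℕ} (G : SimpleGraph (Fin n)) : World where
  n := n
  adj i j := ∃ (hi : i < n) (hj : j < n), G.Adj ⟨i, hi⟩ ⟨j, hj⟩

/-- The complement of `G` as a graph on the natural numbers -/
def SimpleGraph.natCompl {n : ℕ} (G : SimpleGraph (Fin n)) : SimpleGraph ℕ :=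
  Gᶜ.map Fin.valEmbedding

section Input

variable {n : ℕ} {G : SimpleGraph (Fin n)}

theorem natCompl_adj {a b : ℕ} : G.natCompl.Adj a b ↔
    ∃ (ha : a < n) (hb : b < n), a ≠ b ∧ ¬ G.Adj ⟨a, ha⟩ ⟨b, hb⟩ := by
  rw [SimpleGraph.natCompl, SimpleGraph.map_adj]
  constructor
  · rintro ⟨u, v, h, rfl, rfl⟩
    rw [SimpleGraph.compl_adj] at h
    exact ⟨u.2, v.2, fun h' => h.1 (Fin.ext h'), h.2⟩
  · rintro ⟨ha, hb, hne, h⟩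
    refine ⟨⟨a, ha⟩, ⟨b, hb⟩, ?_, rfl, rfl⟩
    rw [SimpleGraph.compl_adj]
    exact ⟨fun h' => hne (congrArg Fin.val h'), h⟩

theorem coAdj_world {a b : ℕ} : G.world.CoAdj a b ↔ G.natCompl.Adj a b := by
  rw [natCompl_adj, World.CoAdj]
  constructor
  · rintro ⟨ha, hb, hne, h⟩
    exact ⟨ha, hb, hne, fun h' => h ⟨ha, hb, h'⟩⟩
  · rintro ⟨ha, hb, hne, h⟩
    exact ⟨ha, hb, hne, fun ⟨_, _, h'⟩ => h h'⟩

theorem isComparabilityGraph_natCompl (h : IsCocomparabilityGraph G) :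
    IsComparabilityGraph G.natCompl := by
  obtain ⟨r, hr⟩ := h
  refine ⟨fun a b => ∃ (ha : a < n) (hb : b < n), r ⟨a, ha⟩ ⟨b, hb⟩, ?_, ?_, ?_⟩
  · rintro a b ⟨ha, hb, h⟩
    exact (SimpleGraph.map_adj _ _ _ _).2 ⟨_, _, hr.adj_of_rel _ _ h, rfl, rfl⟩
  · intro a b h
    obtain ⟨u, v, h', rfl, rfl⟩ := (SimpleGraph.map_adj _ _ _ _).1 h
    have := hr.oriented u v h'
    simpa using this
  · rintro a b c ⟨ha, hb, h⟩ ⟨_, hc, h'⟩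
    exact ⟨ha, hc, hr.trans _ _ _ h h'⟩

theorem leadOrient_lt {a b : ℕ} (h : leadOrient G.natCompl a b) : a < n ∧ b < n := by
  obtain ⟨i, j, hs, -⟩ := h
  obtain ⟨ha, hb, -⟩ := natCompl_adj.1 hs.adj_left
  exact ⟨ha, hb⟩

variable {c : ℕ}

theorem sameDir_of_rule {S : Set (List ℕ)}
    (hS : ∀ y ∈ S, SameDir G.natCompl (y.getD 0 0) (y.getD 1 0) (y.getD 2 0) (y.getD 3 0))
    {y : List ℕ} (h : SameDirRule c G.world y (∅ ∪ (1 :: ·) '' S)) :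
    SameDir G.natCompl (y.getD 0 0) (y.getD 1 0) (y.getD 2 0) (y.getD 3 0) := by
  obtain ⟨h1, h2⟩ := h
  simp only [coAdj_world, Set.empty_union, Set.mem_image, List.cons.injEq, true_and,
    exists_eq_right] at h1 h2
  rcases h2 with ⟨h2, h3⟩ | ⟨v, -, h2⟩
  · rw [h2, h3]
    exact .refl h1
  · rcases h2 with ⟨h2, h3⟩ | ⟨h2, h3⟩
    · exact (hS _ h2).left h1 h3
    · exact (hS _ h2).right h1 h3

/-- The table that contains the relation `SameDir` -/
noncomputable def sameDirTable (c : ℕ) (w : World) (T : Set (List ℕ)) : Set (List ℕ) :=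
  closeTable 1 4 (SameDirRule c w) (w.n + c + 2) T

theorem mem_sameDirTable {l : List ℕ} : l ∈ sameDirTable c G.world ∅ ↔
    ∃ a b u v, l = [1, a, b, u, v] ∧ SameDir G.natCompl a b u v := by
  constructor
  · intro h
    obtain ⟨S, hS, hS'⟩ := closeTable_sound (a := 1) (m := 4) (ψ := SameDirRule c G.world)
      (G.world.n + c + 2) ∅ _ fun S hS y _ => sameDir_of_rule hS
    rw [sameDirTable, hS, Set.empty_union] at h
    obtain ⟨y, hy, rfl⟩ := h
    obtain ⟨h1, h2⟩ := hS' y hy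
    have hl := (mem_tuples.1 h1).1
    match y, hl, h2 with
    | [a, b, u, v], _, h2 => exact ⟨a, b, u, v, rfl, h2⟩
  · rintro ⟨a, b, u, v, rfl, h⟩
    have hmem : ∀ {u v}, SameDir G.natCompl a b u v →
        [a, b, u, v] ∈ tuples (G.world.n + c + 2) 4 := by
      intro u v h
      obtain ⟨h1, h2, -⟩ := natCompl_adj.1 h.adj_left
      obtain ⟨h3, h4, -⟩ := natCompl_adj.1 h.adj_right
      have hn : G.world.n = n := rfl
      simp only [mem_tuples, List.length_cons, List.length_nil, List.mem_cons, List.not_mem_nil,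
        or_false, forall_eq_or_imp, forall_eq, true_and, hn]
      omega
    have hlt : ∀ {u}, u < n → u < G.world.n + c + 2 := fun {u} hu => by
      have hn : G.world.n = n := rfl
      omega
    induction h with
    | refl h =>
      exact closeTable_closed (hmem (.refl h)) ⟨coAdj_world.2 h, .inl ⟨rfl, rfl⟩⟩
    | @left u v u' h h1 h2 ih =>
      refine closeTable_closed (hmem (h.left h1 h2)) ⟨coAdj_world.2 h1, .inr ⟨u, ?_, .inl ⟨ih, ?_⟩⟩⟩
      · exact hlt (natCompl_adj.1 h.adj_right).1
      · rw [coAdj_world]; exact h2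
    | @right u v v' h h1 h2 ih =>
      refine closeTable_closed (hmem (h.right h1 h2)) ⟨coAdj_world.2 h1, .inr ⟨v, ?_, .inr ⟨ih, ?_⟩⟩⟩
      · exact hlt (natCompl_adj.1 h.adj_right).2.1
      · rw [coAdj_world]; exact h2

theorem leadRel_eq_leadOrient {T : Set (List ℕ)} {B : ℕ} (hB : n ≤ B)
    (hT : ∀ a b u v, [1, a, b, u, v] ∈ T ↔ SameDir G.natCompl a b u v) :
    LeadRel B T = leadOrient G.natCompl := by
  have hlt : ∀ {a b u v}, SameDir G.natCompl a b u v → u < B ∧ v < B := by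
    intro a b u v h
    obtain ⟨h1, h2, -⟩ := natCompl_adj.1 h.adj_right
    omega
  funext a b
  simp only [LeadRel, leadOrient, IsLeader, hT, eq_iff_iff]
  constructor
  · rintro ⟨i, _, j, _, h, h'⟩
    refine ⟨i, j, h, fun i' j' hij => ?_⟩
    rcases id hij with h1 | h1
    · exact h' i' (hlt h1).1 j' (hlt h1).2 hij
    · exact h' i' (hlt h1).2 j' (hlt h1).1 hij
  · rintro ⟨i, j, h, h'⟩
    exact ⟨i, (hlt h).1, j, (hlt h).2, h, fun i' _ j' _ => h' i' j'⟩

/-- The table of the states for `k` chains, added to the table `T` -/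
noncomputable def chainTable (c k : ℕ) (w : World) (T : Set (List ℕ)) : Set (List ℕ) :=
  closeTable (k + 2) (k + k) (TableChainRule c k w) (w.n + c + 2) T

theorem acceptRule_iff {T : Set (List ℕ)} {k : ℕ} (hG : IsCocomparabilityGraph G)
    (hT : ∀ a b u v, [1, a, b, u, v] ∈ T ↔ SameDir G.natCompl a b u v)
    (hk : ∀ y, (k + 2) :: y ∉ T) {y : List ℕ} (hy : y ∈ tuples (n + c + 2) k) :
    AcceptRule c k G.world y (chainTable c k G.world T) ↔
      ∃ C : G.Coloring (Fin k), coloringType C = y := by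
  have hn : G.world.n = n := rfl
  have hor := isTransitiveOrientation_leadOrient (isComparabilityGraph_natCompl hG)
  have hr : ∀ u v, leadOrient G.natCompl u v → u < n ∧ v < n := fun u v => leadOrient_lt
  have hirr : ∀ u, ¬ leadOrient G.natCompl u u := fun u h => (hor.adj_of_rel _ _ h).ne rfl
  have hyl := (mem_tuples.1 hy).1
  have hdir : ∀ S : Set (List ℕ), ∀ a b u v,
      [1, a, b, u, v] ∈ T ∪ ((k + 2) :: ·) '' S ↔ SameDir G.natCompl a b u v := by
    intro S a b u v
    rw [← hT]
    simp
  have hlead : ∀ S : Set (List ℕ), LeadRel (n + c + 2) (T ∪ ((k + 2) :: ·) '' S) =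
      leadOrient G.natCompl := fun S => leadRel_eq_leadOrient (by omega) (hdir S)
  have hmark : ∀ S : Set (List ℕ), {z | (k + 2) :: z ∈ T ∪ ((k + 2) :: ·) '' S} = S := by
    intro S
    ext z
    simp [hk]
  obtain ⟨S, hS, hS'⟩ := closeTable_sound (a := k + 2) (m := k + k)
    (ψ := TableChainRule c k G.world) (G.world.n + c + 2) T
    (fun y => ∃ col D, IsChainState n k (leadOrient G.natCompl) col D (fun i => y.getD i 0)
      fun i => y.getD (k + i) 0) fun S hS y _ h => by
        simp only [TableChainRule, hn, hlead, hmark] at h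
        exact h.sound hr (by omega) hor.trans hS
  have hclosed : ∀ s t : ℕ → ℕ, (∀ i < k, s i < n + c + 2) → (∀ i < k, t i < n + c + 2) →
      ChainRule n (n + c + 2) k (leadOrient G.natCompl) s t S → stateCode k s t ∈ S := by
    intro s t hs ht h
    have h1 : (k + 2) :: stateCode k s t ∈ chainTable c k G.world T := by
      refine closeTable_closed (mem_tuples.2 ⟨length_stateCode k s t, ?_⟩) ?_
      · intro x hx
        simp only [stateCode, List.mem_append, List.mem_map, List.mem_range] at hx
        rcases hx with ⟨i, hi, rfl⟩ | ⟨i, hi, rfl⟩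
        · exact hs i hi
        · exact ht i hi
      · rw [hS]
        simp only [TableChainRule, hn, hlead, hmark]
        exact h.congr (fun i hi => (getD_stateCode_left s t hi).symm)
          fun i hi => (getD_stateCode_right s t hi).symm
    rw [chainTable, hS] at h1
    have : stateCode k s t ∈ {z | (k + 2) :: z ∈ T ∪ ((k + 2) :: ·) '' S} := h1
    rwa [hmark] at this
  have hacc : AcceptRule c k G.world y (chainTable c k G.world T) ↔
      (∀ i < k, ∀ j < k, i < j → y.getD i 0 ≤ y.getD j 0) ∧ ∃ z ∈ tuples (n + c + 2) k,
        CoversAll n k (leadOrient G.natCompl) (fun i => z.getD i 0) ∧ y ++ z ∈ S := by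
    have hm : ∀ z, (k + 2) :: z ∈ T ∪ ((k + 2) :: ·) '' S ↔ z ∈ S := fun z => by
      conv_rhs => rw [← hmark S]
      rfl
    rw [chainTable, hS]
    simp only [AcceptRule, hn, hlead, hm]
  rw [hacc]
  constructor
  · rintro ⟨hsort, z, -, hcov, hz⟩
    obtain ⟨-, col, D, hD⟩ := hS' _ hz
    have hcov' : CoversAll n k (leadOrient G.natCompl) fun i => (y ++ z).getD (k + i) 0 := by
      have : (fun i => (y ++ z).getD (k + i) 0) = fun i => z.getD i 0 := by
        funext i
        rw [List.getD_append_right _ _ _ _ (by omega)]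
        congr 1
        omega
      rwa [this]
    obtain rfl := hD.eq_range hr hcov'
    have hcol : ∀ v : Fin n, col v < k := fun v => hD.col_lt v (Finset.mem_range.2 v.2)
    let C : G.Coloring (Fin k) := SimpleGraph.Coloring.mk (fun v => ⟨col v, hcol v⟩) fun {u v} h h' => by
      have hne : (u : ℕ) ≠ v := fun h'' => h.ne (Fin.ext h'')
      have : G.natCompl.Adj u v := by
        rcases hD.chain u (Finset.mem_range.2 u.2) v (Finset.mem_range.2 v.2)
          (congrArg Fin.val h') hne with h1 | h1
        · exact hor.adj_of_rel _ _ h1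
        · exact (hor.adj_of_rel _ _ h1).symm
      obtain ⟨_, _, _, h2⟩ := natCompl_adj.1 this
      exact h2 h
    refine ⟨C, ?_⟩
    have hyf : y = List.ofFn fun i : Fin k => y.getD i 0 := by
      refine List.ext_getElem (by simp [hyl]) fun i h1 h2 => ?_
      simp [h1]
    rw [hyf]
    refine coloringType_of_monotone C (fun i => ?_) fun i j hij => ?_
    · have hi := hD.card i i.2
      rw [List.getD_append _ _ _ _ (by rw [hyl]; exact i.2)] at hi
      rw [hi, ncard_eq_card_filter_range]
      congr 1
      refine Finset.filter_congr fun v hv => ?_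
      rw [Finset.mem_range] at hv
      constructor
      · rintro ⟨_, h⟩
        exact congrArg Fin.val (show (⟨col v, _⟩ : Fin k) = i from h)
      · intro h
        exact ⟨hv, show (⟨col v, _⟩ : Fin k) = i from Fin.ext h⟩
    · rcases hij.eq_or_lt with rfl | hij
      · exact le_rfl
      · exact hsort i i.2 j j.2 hij
  · rintro ⟨C₀, rfl⟩
    obtain ⟨C, hm, hC⟩ := exists_coloring_monotone C₀
    rw [← hC] at hyl ⊢
    have hty := coloringType_of_monotone C (fun _ => rfl) hm
    have hget : ∀ i (hi : i < k), (coloringType C).getD i 0 = (C.colorClass ⟨i, hi⟩).ncard := by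
      intro i hi
      rw [hty]
      simp [hi]
    refine ⟨fun i hi j hj hij => ?_, ?_⟩
    · rw [hget i hi, hget j hj]
      exact hm (show (⟨i, hi⟩ : Fin k) ≤ ⟨j, hj⟩ from hij.le)
    let col : ℕ → ℕ := fun v => if h : v < n then C ⟨v, h⟩ else 0
    have hcol : ∀ v (h : v < n), col v = C ⟨v, h⟩ := fun v h => dif_pos h
    obtain ⟨D, s, t, hDn, hD, hmem⟩ := exists_chainState_of_closed (n := n) (B := n + c + 2) (k := k)
      hr (by omega) hor.trans hirr hclosed (col := col)
      (fun v hv => by rw [hcol v hv]; exact (C ⟨v, hv⟩).2)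
      (fun u hu v hv huv hne => by
        rw [hcol u hu, hcol v hv] at huv
        have hadj : G.natCompl.Adj u v := natCompl_adj.2
          ⟨hu, hv, hne, fun h => C.valid h (Fin.ext huv)⟩
        exact (hor.oriented _ _ hadj).or) n le_rfl
    have hDr : D = Finset.range n :=
      Finset.eq_of_subset_of_card_le (fun v hv => Finset.mem_range.2 (hD.lt v hv)) (by simp [hDn])
    obtain ⟨htup, -⟩ := hS' _ hmem
    refine ⟨(List.range k).map t, ?_, ?_, ?_⟩
    · rw [mem_tuples]
      refine ⟨by simp, fun x hx => (mem_tuples.1 htup).2 x (List.mem_append_right _ hx)⟩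
    · intro u hu
      obtain ⟨i, hi, h⟩ := (hD.mem_iff hr hu).1 (by rw [hDr]; exact Finset.mem_range.2 hu)
      refine ⟨i, hi, ?_⟩
      have : ((List.range k).map t).getD i 0 = t i := by simp [hi]
      simpa only [this] using h
    · have : coloringType C = (List.range k).map s := by
        refine List.ext_getElem (by simp [hyl]) fun i h1 h2 => ?_
        have hi : i < k := hyl ▸ h1
        rw [← List.getD_eq_getElem _ 0 h1, hget i hi, ncard_eq_card_filter_range]
        simp only [List.getElem_map, List.getElem_range]
        rw [hD.card i hi, hDr]
        congr 1
        refine Finset.filter_congr fun v hv => ?_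
        rw [Finset.mem_range] at hv
        rw [hcol v hv]
        constructor
        · rintro ⟨_, h⟩
          exact congrArg Fin.val (show C ⟨v, hv⟩ = ⟨i, hi⟩ from h)
        · intro h
          exact ⟨hv, show C ⟨v, hv⟩ = ⟨i, hi⟩ from Fin.ext h⟩
      rw [this]
      exact hmem

end Input

/-! ### The algorithm -/

open Classical in
/-- Output all lists of sizes of partitions into `k` chains and mark the table with `[0]` if there
are any. -/
noncomputable def report (c k : ℕ) (w : World) (σ : Set (List ℕ) × List ℕ) :
    Set (List ℕ) × List ℕ :=
  (tuples (w.n + c + 2) k).foldl (fun σ y =>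
    if AcceptRule c k w y σ.1 then (insert [0] σ.1, σ.2 ++ k :: y) else σ) σ

open Classical in
/-- Unless the table is marked with `[0]` already, treat the partitions into `k` chains. -/
noncomputable def tryChains (c k : ℕ) (w : World) (σ : Set (List ℕ) × List ℕ) :
    Set (List ℕ) × List ℕ :=
  if [0] ∈ σ.1 then σ else report c k w (chainTable c k w σ.1, σ.2)

/-- Treat the partitions into `0`, …, `k - 1` chains, one after the other. -/
noncomputable def typesUpTo (c : ℕ) (w : World) (σ : Set (List ℕ) × List ℕ) :
    ℕ → Set (List ℕ) × List ℕ
  | 0 => (sameDirTable c w σ.1, σ.2)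
  | k + 1 => tryChains c k w (typesUpTo c w σ k)

theorem Cmd.report {c k d : ℕ} (hk : k < c) : Cmd c d fun w _ σ => _root_.report c k w σ := by
  classical
  have h1 : Cmd c (d + k) fun _ env σ => (insert (0 :: ([] : List ℕ).map env) σ.1,
      σ.2 ++ [k] ++ (List.range' d k).map env) :=
    ((Cmd.insertTuple 0 [] (by omega) (by simp)).seq (Cmd.print_const k)).seq
      (Cmd.print_vars (List.range' d k) fun x hx => by simp at hx; omega)
  have h2 := (Cmd.ite (Dec.acceptRule hk d) h1 Cmd.skip).forTuple
  convert h2 using 4 with w env σ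
  have : ∀ L : List (List ℕ), L ⊆ tuples (w.n + c + 2) k → ∀ σ : Set (List ℕ) × List ℕ,
      L.foldl (fun σ y =>
        if AcceptRule c k w y σ.1 then (insert [0] σ.1, σ.2 ++ k :: y) else σ) σ =
      L.foldl (fun σ y =>
        if AcceptRule c k w ((List.range' d k).map (assign env d y)) σ.1 then
          (insert [0] σ.1, σ.2 ++ [k] ++ (List.range' d k).map (assign env d y))
        else σ) σ := by
    intro L
    induction L with
    | nil => exact fun _ _ => rfl
    | cons y L ih =>
      intro hL σ
      rw [List.foldl_cons, List.foldl_cons, ih fun x hx => hL (List.mem_cons_of_mem _ hx),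
        map_assign y (mem_tuples.1 (hL List.mem_cons_self)).1]
      simp
  exact this _ (fun _ h => h) σ

theorem Cmd.tryChains {c k d : ℕ} (hk : k < c) (hd : 0 < d) :
    Cmd c d fun w _ σ => _root_.tryChains c k w σ := by
  have h := Cmd.ite (Dec.mem_table (d := d) 0 [] (by omega) (by simp)) Cmd.skip
    ((Cmd.closeTable (a := k + 2) (by omega) (k + k) hd
      (ψ := TableChainRule c k) fun e _ => Dec.tableChainRule hk e).seq (Cmd.report hk))
  exact h

theorem Cmd.typesUpTo {c d : ℕ} (hd : 0 < d) (k : ℕ) (hk : k ≤ c) :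
    Cmd c d fun w _ σ => _root_.typesUpTo c w σ k := by
  induction k with
  | zero =>
    exact Cmd.closeTable (a := 1) (by omega) 4 hd (ψ := SameDirRule c) fun e _ =>
      Dec.sameDirRule e
  | succ k ih => exact (ih (by omega)).seq (Cmd.tryChains (by omega) hd)

theorem leadRel_insert_mark {B : ℕ} {T : Set (List ℕ)} :
    LeadRel B (insert [0] T) = LeadRel B T := by
  funext a b
  simp [LeadRel]

theorem acceptRule_insert_mark {c k : ℕ} {w : World} {y : List ℕ} {T : Set (List ℕ)} :
    AcceptRule c k w y (insert [0] T) ↔ AcceptRule c k w y T := by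
  simp [AcceptRule, leadRel_insert_mark]

open Classical in
theorem report_eq (c k : ℕ) (w : World) (T : Set (List ℕ)) (out : List ℕ) :
    report c k w (T, out) =
      (if ∃ y ∈ tuples (w.n + c + 2) k, AcceptRule c k w y T then insert [0] T else T,
        out ++ ((tuples (w.n + c + 2) k).filter fun y => AcceptRule c k w y T).flatMap (k :: ·)) := by
  have : ∀ (L : List (List ℕ)) (σ : Set (List ℕ) × List ℕ), σ.1 = T ∨ σ.1 = insert [0] T →
      L.foldl (fun σ y =>
        if AcceptRule c k w y σ.1 then (insert [0] σ.1, σ.2 ++ k :: y) else σ) σ =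
      (if ∃ y ∈ L, AcceptRule c k w y T then insert [0] T else σ.1,
        σ.2 ++ (L.filter fun y => AcceptRule c k w y T).flatMap (k :: ·)) := by
    intro L
    induction L with
    | nil => exact fun σ _ => by simp
    | cons y L ih =>
      intro σ hσ
      have hacc : AcceptRule c k w y σ.1 ↔ AcceptRule c k w y T := by
        rcases hσ with h | h <;> rw [h]
        exact acceptRule_insert_mark
      have hins : insert [0] σ.1 = insert [0] T := by
        rcases hσ with h | h <;> rw [h]
        exact Set.insert_eq_of_mem (Set.mem_insert _ _)
      rw [List.foldl_cons]
      by_cases hy : AcceptRule c k w y T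
      · rw [if_pos (hacc.2 hy), ih _ (.inr hins)]
        simp [hy, hins]
      · rw [if_neg (fun h => hy (hacc.1 h)), ih _ hσ]
        simp [hy]
  have h := this (tuples (w.n + c + 2) k) (T, out) (.inl rfl)
  rw [report]
  convert h

section Correctness

variable {n c : ℕ} {G : SimpleGraph (Fin n)}

theorem coloringType_mem_tuples {k : ℕ} (C : G.Coloring (Fin k)) :
    coloringType C ∈ tuples (n + c + 2) k := by
  refine mem_tuples.2 ⟨length_coloringType C, fun x hx => ?_⟩
  have := le_card_of_mem_coloringType C hx
  rw [Nat.card_fin] at this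
  omega

theorem exists_acceptRule_iff {T : Set (List ℕ)} {k : ℕ} (hG : IsCocomparabilityGraph G)
    (hT : ∀ a b u v, [1, a, b, u, v] ∈ T ↔ SameDir G.natCompl a b u v)
    (hk : ∀ y, (k + 2) :: y ∉ T) :
    (∃ y ∈ tuples (G.world.n + c + 2) k, AcceptRule c k G.world y (chainTable c k G.world T)) ↔
      G.Colorable k := by
  constructor
  · rintro ⟨y, hy, h⟩
    obtain ⟨C, -⟩ := (acceptRule_iff hG hT hk hy).1 h
    exact ⟨C⟩
  · rintro ⟨C⟩
    exact ⟨_, coloringType_mem_tuples C,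
      (acceptRule_iff hG hT hk (coloringType_mem_tuples C)).2 ⟨C, rfl⟩⟩

open Classical in
/-- The list of the types of all colorings with `k` available colors -/
noncomputable def typeList (c k : ℕ) (G : SimpleGraph (Fin n)) : List (List ℕ) :=
  (tuples (n + c + 2) k).filter fun y => ∃ C : G.Coloring (Fin k), coloringType C = y

theorem mem_typeList {k : ℕ} {y : List ℕ} :
    y ∈ typeList c k G ↔ ∃ C : G.Coloring (Fin k), coloringType C = y := by
  simp only [typeList, List.mem_filter, decide_eq_true_eq, and_iff_right_iff_imp]
  rintro ⟨C, rfl⟩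
  exact coloringType_mem_tuples C

theorem encodeTypes_typeList (k : ℕ) :
    encodeTypes (typeList c k G) = (typeList c k G).flatMap (k :: ·) := by
  refine List.flatMap_congr fun y hy => ?_
  obtain ⟨C, rfl⟩ := mem_typeList.1 hy
  rw [length_coloringType]

/-- The result of treating the partitions into fewer than `k` chains -/
structure IsCorrectUpTo (c k : ℕ) (G : SimpleGraph (Fin n)) (σ : Set (List ℕ) × List ℕ) : Prop where
  sameDir : ∀ a b u v, [1, a, b, u, v] ∈ σ.1 ↔ SameDir G.natCompl a b u v
  unused : ∀ j, k ≤ j → ∀ y, (j + 2) :: y ∉ σ.1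
  result : ([0] ∉ σ.1 ∧ σ.2 = [] ∧ ∀ j < k, ¬ G.Colorable j) ∨
    ([0] ∈ σ.1 ∧ ∃ j < k, G.Colorable j ∧ (∀ i < j, ¬ G.Colorable i) ∧
      σ.2 = encodeTypes (typeList c j G))

theorem isCorrectUpTo_typesUpTo (hG : IsCocomparabilityGraph G) (k : ℕ) :
    IsCorrectUpTo c k G (typesUpTo c G.world (∅, []) k) := by
  classical
  induction k with
  | zero =>
    refine ⟨fun a b u v => ?_, fun j _ y => ?_, .inl ⟨?_, rfl, by simp⟩⟩
    · simp only [typesUpTo, mem_sameDirTable]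
      constructor
      · rintro ⟨_, _, _, _, h, h'⟩
        simp only [List.cons.injEq, true_and, and_true] at h
        obtain ⟨rfl, rfl, rfl, rfl⟩ := h
        exact h'
      · exact fun h => ⟨_, _, _, _, rfl, h⟩
    · simp [typesUpTo, mem_sameDirTable]
    · simp [typesUpTo, mem_sameDirTable]
  | succ k ih =>
    rw [typesUpTo]
    generalize typesUpTo c G.world (∅, []) k = σ at ih ⊢
    obtain ⟨T, out⟩ := σ
    rcases ih.result with ⟨h0, rfl, hcol⟩ | ⟨h0, j, hj, h⟩
    · have hT := ih.sameDir
      have hk := ih.unused k le_rfl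
      rw [tryChains, if_neg h0, report_eq]
      have hmem : ∀ l, (∀ y, l ≠ (k + 2) :: y) → (l ∈ chainTable c k G.world T ↔ l ∈ T) :=
        fun l hl => mem_closeTable_of_ne hl
      have hfil : ((tuples (G.world.n + c + 2) k).filter fun y =>
          AcceptRule c k G.world y (chainTable c k G.world T)) = typeList c k G :=
        List.filter_congr fun y hy => by
          simp only [decide_eq_decide]
          exact acceptRule_iff hG hT hk hy
      simp only [exists_acceptRule_iff hG hT hk]
      rw [hfil, ← encodeTypes_typeList]
      by_cases hc : G.Colorable k
      · simp only [if_pos hc]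
        refine ⟨fun a b u v => ?_, fun j hj y => ?_, .inr ⟨Set.mem_insert _ _, k, by omega, hc, hcol,
          rfl⟩⟩
        · rw [Set.mem_insert_iff, hmem _ (by simp), ← hT]
          simp
        · rw [Set.mem_insert_iff, hmem _ (by simp; omega)]
          simpa using ih.unused j (by omega) y
      · simp only [if_neg hc]
        refine ⟨fun a b u v => ?_, fun j hj y => ?_, .inl ⟨?_, ?_, fun j hj => ?_⟩⟩
        · rw [hmem _ (by simp), ← hT]
        · rw [hmem _ (by simp; omega)]
          exact ih.unused j (by omega) y
        · rw [hmem _ (by simp)]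
          exact h0
        · have : typeList c k G = [] := List.eq_nil_iff_forall_not_mem.2 fun y hy => by
            obtain ⟨C, -⟩ := mem_typeList.1 hy
            exact hc ⟨C⟩
          rw [this]
          rfl
        · rcases Nat.lt_succ_iff_lt_or_eq.1 hj with hj | rfl
          · exact hcol j hj
          · exact hc
    · rw [tryChains, if_pos h0]
      exact ⟨ih.sameDir, fun i hi => ih.unused i (by omega), .inr ⟨h0, j, by omega, h⟩⟩

end Correctness

/-! ### The initial state -/

theorem getD_flatMap {α : Type*} {f : α → List ℕ} {n : ℕ} (hf : ∀ a, (f a).length = n) (l : List α)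
    {i j : ℕ} (hi : i < l.length) (hj : j < n) :
    (l.flatMap f).getD (i * n + j) 0 = (f l[i]).getD j 0 := by
  induction l generalizing i with
  | nil => simp at hi
  | cons a l ih =>
    rw [List.flatMap_cons]
    cases i with
    | zero =>
      rw [List.getD_append _ _ _ _ (by rw [hf]; omega)]
      simp
    | succ i =>
      rw [List.getD_append_right _ _ _ _ (by rw [hf, Nat.succ_mul]; omega), hf]
      have : (i + 1) * n + j - n = i * n + j := by rw [Nat.succ_mul]; omega
      rw [this, ih (by simpa using hi)]
      simp

theorem length_encodeGraph {n : ℕ} (G : SimpleGraph (Fin n)) :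
    (encodeGraph G).length = n * n + 1 := by
  simp [encodeGraph, List.length_flatMap]

theorem getD_encodeGraph {n : ℕ} (G : SimpleGraph (Fin n)) {i j : ℕ} (hi : i < n) (hj : j < n) :
    (encodeGraph G).getD (1 + (i * n + j)) 0 = propBit (G.world.adj i j) := by
  have hadj : G.world.adj i j ↔ G.Adj ⟨i, hi⟩ ⟨j, hj⟩ :=
    ⟨fun ⟨_, _, h⟩ => h, fun h => ⟨hi, hj, h⟩⟩
  rw [encodeGraph, add_comm 1, List.getD_cons_succ, getD_flatMap (n := n) (by simp) _ (by simpa) hj,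
    hadj]
  have h1 : ∀ i (hi : i < n), (List.finRange n)[i]'(by simpa) = ⟨i, hi⟩ := fun i hi => by simp
  rw [h1 i hi, List.getD_eq_getElem _ _ (by simpa), List.getElem_map, h1 j hj]
  rfl

/-- The program that prepares the registers -/
def setup (c : ℕ) : RAMProgram :=
  .seq (.load 7 0) (.seq (.const 1 (c + 2)) (.seq (.add 2 7 1) (.const 3 1)))

theorem exec_setup (c : ℕ) {n : ℕ} (G : SimpleGraph (Fin n)) :
    ∃ s, RAMExec (setup c) (RAMState.init (encodeGraph G)) s 4 ∧
      Represents c G.world 1 (fun _ => n) ∅ [] s := by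
  have hn : G.world.n = n := rfl
  have h0 : (encodeGraph G).getD 0 0 = n := rfl
  refine ⟨_, .seq (.load _ _ _) (.seq (.const _ _ _) (.seq (.add _ _ _ _) (.const _ _ _))), ?_⟩
  constructor
  · simp [RAMState.init, h0, hn, add_assoc, -List.getD_eq_getElem?_getD]
  · simp
  · intro i hi
    obtain rfl : i = 0 := by omega
    simp [RAMState.init, h0, -List.getD_eq_getElem?_getD]
  · intro i _
    rw [hn]
    omega
  · omega
  · rfl
  · intro i hi j hj
    exact getD_encodeGraph G hi hj
  · intro l _
    have h1 := le_cellCode (B := G.world.n + c + 2) (by omega) l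
    have h2 : n * n + 1 ≤ (G.world.n + c + 2) * (G.world.n + c + 2) := by rw [hn]; nlinarith
    simp only [RAMState.setReg_mem, RAMState.init, Set.mem_empty_iff_false, propBit_false]
    exact List.getD_eq_default _ _ (by rw [length_encodeGraph]; omega)
  · rfl

theorem mainTheorem12 (K : ℕ) :
    ∃ (P : RAMProgram) (p : Polynomial ℕ),
      ∀ (n : ℕ) (G : SimpleGraph (Fin n)),
        IsCocomparabilityGraph G → G.chromaticNumber ≤ (K : ℕ∞) →
          ∃ L : List (List ℕ),
            L.Nodup ∧ (∀ l : List ℕ, l ∈ L ↔ IsOptimalColoringType G l) ∧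
              P.OutputsWithin (encodeGraph G) (encodeTypes L) (p.eval n) := by
  obtain ⟨P, p, hP⟩ := Cmd.typesUpTo (c := K + 1) (d := 1) Nat.one_pos (K + 1) le_rfl
  refine ⟨.seq (setup (K + 1)) P, 4 + p, fun n G hG hK => ?_⟩
  obtain ⟨s, e, h⟩ := exec_setup (K + 1) G
  obtain ⟨s', t, e', h', ht⟩ := hP _ _ _ _ _ h
  have hc := isCorrectUpTo_typesUpTo (c := K + 1) hG (K + 1)
  obtain ⟨j, hj, hmin, hout⟩ : ∃ j, G.Colorable j ∧ (∀ i < j, ¬ G.Colorable i) ∧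
      (typesUpTo (K + 1) G.world (∅, []) (K + 1)).2 = encodeTypes (typeList (K + 1) j G) := by
    rcases hc.result with ⟨-, -, h⟩ | ⟨-, j, -, h⟩
    · exact absurd (SimpleGraph.chromaticNumber_le_iff_colorable.1 hK) (h K (by omega))
    · exact ⟨j, h⟩
  have hχ : G.chromaticNumber = j := by
    refine le_antisymm (SimpleGraph.chromaticNumber_le_iff_colorable.2 hj) ?_
    by_contra hlt
    rw [not_le] at hlt
    obtain ⟨i, hi⟩ := ENat.ne_top_iff_exists.1 (ne_top_of_lt hlt)
    rw [← hi, Nat.cast_lt] at hlt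
    exact hmin i hlt (SimpleGraph.chromaticNumber_le_iff_colorable.1 hi.ge)
  refine ⟨typeList (K + 1) j G, (nodup_tuples _ _).filter _, fun l => ?_, s', 4 + t, .seq e e', ?_, ?_⟩
  · rw [mem_typeList]
    constructor
    · exact fun h => ⟨j, hχ, h⟩
    · rintro ⟨k, hk, h⟩
      obtain rfl : j = k := by rw [hχ] at hk; exact_mod_cast hk
      exact h
  · exact h'.out.trans hout
  · have ht : t ≤ p.eval n := ht
    simpa using ht
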